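/- Let $n\ge 1$ be an integer, $R>0$, and let $\ell$ be a real number with $\lfloor\ell\rfloor\ge n+1$. Functions on $D\times\mathbb T^n$, $\mathbb T^n=\mathbb R^n/2\pi\mathbb Z^n$, are identified with functions on $D\times\mathbb R^n$ that are $2\pi\mathbb Z^n$-periodic in the last $n$ variables, and $B_\infty(0,R)\subset\mathbb R^n$ is the open ball of the max norm. For an open set $D$ and an integer $q\ge0$ put $\|f\|_{C^q(D)}=\sup_{|\alpha|\le q}\sup_{x\in D}|\partial^\alpha f(x)|$. For real $\ell>0$ with $q=\lfloor\ell\rfloor$, $\mu=\ell-q$, put $|f|_{C^\ell(D)}=\|f\|_{C^q(D)}$ if $\mu=0$, and $$|f|_{C^\ell(D)}=\|f\|_{C^q(D)}+\sup_{|\alpha|=q}\ \sup_{x,y\in D,\ 0<|x-y|<1}\frac{|\partial^\alpha f(x)-\partial^\alpha f(y)|}{|x-y|^\mu}$$ if $\mu\in(0,1)$, where $|x-y|$ is the Euclidean norm. A real-valued function $f$ is said to be of class $C^\ell$ on $D$ if it is $q$ times continuously differentiable on $D$ and $|f|_{C^\ell(D)}<\infty$. For $s>0$ let $$\mathbb R^n_s=\{I\in\mathbb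 C^n:\ |\operatorname{Im} I|_2<s\},\qquad \mathbb T^n_s=\{\theta\in\mathbb C^n/2\pi\mathbb Z^n:\ \max_j|\operatorname{Im}\theta_j|<s\},\qquad \mathbb A^n_s=\mathbb R^n_s\times\mathbb T^n_s,$$ and for a function $g$ on $\mathbb A^n_s$ let $$\|g\|_{s,s}=\sup_{I\in\mathbb R^n_s}\sum_{k\in\mathbb Z^n}|\hat g_k(I)|\,e^{s|k|_1},\qquad \hat g_k(I)=\frac1{(2\pi)^n}\int_{[0,2\pi]^n}g(I,\theta)e^{-ik\cdot\theta}\,d\theta .$$ **Theorem (Analytic smoothing).** There are positive constants $C_A=C_A(R,\ell,n)$ and $C_B=C_B(R,\ell,n)$ such that for every $s\in(0,1]$ and every real-valued function $f$ of class $C^\ell$ on $B_\infty(0,2R)\times\mathbb T^n$ there is an analytic function $f_s:\mathbb A^n_s\to\mathbb C$, real-valued at real points, which is a trigonometric polynomial in the angles (that is, $f_s(I,\theta)=\sum_{k\in S}a_k(I)e^{ik\cdot\theta}$ with $S\subset\mathbb Z^n$ finite), and which satisfies $$\|f-f_s\|_{C^p(B_\infty(0,R)\times\mathbb T^n)}\le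 C_A\,s^{\ell-p}\,|f|_{C^\ell(B_\infty(0,2R)\times\mathbb T^n)}\qquad\text{for every integer }0\le p\le\lfloor\ell\rfloor,$$ and $$\|f_s\|_{s,s}\le C_B\,|f|_{C^\ell(B_\infty(0,2R)\times\mathbb T^n)}.$$ -/

import Mathlib

open scoped ENNReal

noncomputable section

namespace Smoothing

/-- Points `(I, θ)` of `𝕜ⁿ × 𝕜ⁿ` (actions, then angles) with the Euclidean norm.  Functions on a
product with a torus are functions that are `2πℤⁿ`-periodic in the angles. -/
abbrev Phase (𝕜 : Type) [RCLike 𝕜] (n : ℕ) : Type := EuclideanSpace 𝕜 (Fin n ⊕ Fin n)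

/-- The point `(I, θ)`. -/
def mkPhase {𝕜 : Type} [RCLike 𝕜] {n : ℕ} (I : EuclideanSpace 𝕜 (Fin n)) (θ : Fin n → 𝕜) :
    Phase 𝕜 n :=
  WithLp.toLp 2 (Sum.elim (fun j => I j) θ)

/-- The action component `I` of `(I, θ)`. -/
def actions {𝕜 : Type} [RCLike 𝕜] {n : ℕ} (z : Phase 𝕜 n) : EuclideanSpace 𝕜 (Fin n) :=
  WithLp.toLp 2 (fun j => z (Sum.inl j))

/-- The angle component `θ` of `(I, θ)`. -/
def angles {𝕜 : Type} [RCLike 𝕜] {n : ℕ} (z : Phase 𝕜 n) : Fin n → 𝕜 :=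
  fun j => z (Sum.inr j)

/-- The inclusion of real vectors into complex vectors. -/
def toComplex {ι : Type} (x : EuclideanSpace ℝ ι) : EuclideanSpace ℂ ι :=
  WithLp.toLp 2 (fun j => (x j : ℂ))

/-- `F` is `2πℤⁿ`-periodic in the angles on the set `D` (which will always be invariant under the
translations in question). -/
def AnglePeriodicOn {𝕜 : Type} [RCLike 𝕜] {n : ℕ} {E : Type} (F : Phase 𝕜 n → E)
    (D : Set (Phase 𝕜 n)) : Prop :=
  ∀ z ∈ D, ∀ m : Fin n → ℤ,
    F (mkPhase (actions z) (fun j => angles z j + ((2 * Real.pi * (m j : ℝ) : ℝ) : 𝕜))) = F z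

/-- `B_∞(0, R) × ℝⁿ`, the cover of `B_∞(0, R) × 𝕋ⁿ`. -/
def actionBox (n : ℕ) (R : ℝ) : Set (Phase ℝ n) :=
  {x | ∀ j : Fin n, |actions x j| < R}

section Holder

variable {ι : Type} [Fintype ι] [DecidableEq ι] {E : Type} [NormedAddCommGroup E] [NormedSpace ℝ E]

/-- A list in which each index `i` occurs exactly `α i` times. -/
def multiIndexList (α : ι → ℕ) : List ι :=
  (∑ i, Multiset.replicate (α i) i).toList

/-- The partial derivative `∂^α f (x)`: the derivative of order `|α|` applied to `α i` copies of
each basis vector `e_i`.  It is used only where `f` is `|α|` times continuously differentiable, so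
that the order in which the basis vectors are listed is irrelevant. -/
def partialDeriv (α : ι → ℕ) (f : EuclideanSpace ℝ ι → E) (x : EuclideanSpace ℝ ι) : E :=
  iteratedFDeriv ℝ (multiIndexList α).length f x
    (fun j => EuclideanSpace.single ((multiIndexList α).get j) (1 : ℝ))

/-- `‖f‖_{C^q(D)} = sup_{|α| ≤ q} sup_{x ∈ D} |∂^α f(x)|`, for an open set `D`. -/
def cNorm (q : ℕ) (D : Set (EuclideanSpace ℝ ι)) (f : EuclideanSpace ℝ ι → E) : ℝ≥0∞ :=
  ⨆ α : ι → ℕ, ⨆ _ : ∑ i, α i ≤ q, ⨆ x ∈ D, ‖partialDeriv α f x‖ₑ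

/-- The supremum over `|α| = q` and over `x, y ∈ D` with `0 < |x - y| < 1` of
`|∂^α f(x) - ∂^α f(y)| / |x - y|^μ`. -/
def holderSeminorm (q : ℕ) (μ : ℝ) (D : Set (EuclideanSpace ℝ ι)) (f : EuclideanSpace ℝ ι → E) :
    ℝ≥0∞ :=
  ⨆ α : ι → ℕ, ⨆ _ : ∑ i, α i = q, ⨆ x ∈ D, ⨆ y ∈ D, ⨆ _ : 0 < ‖x - y‖ ∧ ‖x - y‖ < 1,
    ‖partialDeriv α f x - partialDeriv α f y‖ₑ / ENNReal.ofReal (‖x - y‖ ^ μ)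

open Classical in
/-- The norm `|f|_{C^ℓ(D)}` for real `ℓ > 0`: the `C^ℓ` norm if `ℓ` is an integer, and the Hölder
norm with exponents `⌊ℓ⌋` and `ℓ - ⌊ℓ⌋` otherwise. -/
def holderNorm (ℓ : ℝ) (D : Set (EuclideanSpace ℝ ι)) (f : EuclideanSpace ℝ ι → E) : ℝ≥0∞ :=
  if Int.fract ℓ = 0 then cNorm ⌊ℓ⌋₊ D f
  else cNorm ⌊ℓ⌋₊ D f + holderSeminorm ⌊ℓ⌋₊ (Int.fract ℓ) D f

/-- `f` is of class `C^ℓ` on the open set `D`, with finite norm. -/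
def IsHolder (ℓ : ℝ) (D : Set (EuclideanSpace ℝ ι)) (f : EuclideanSpace ℝ ι → E) : Prop :=
  ContDiffOn ℝ (⌊ℓ⌋₊ : ℕ) f D ∧ holderNorm ℓ D f < ⊤

end Holder

/-- The complex extension `D_r` of width `r` of a set `D` of actions. -/
def complexExt {n : ℕ} (D : Set (EuclideanSpace ℝ (Fin n))) (r : ℝ) :
    Set (EuclideanSpace ℂ (Fin n)) :=
  {z | ∃ x ∈ D, ‖z - toComplex x‖ < r}

/-- The complex domain over `D × 𝕋ⁿ`: actions in `D_r`, angles with `max_j |Im θ_j| < s`. -/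
def complexDomain {n : ℕ} (D : Set (EuclideanSpace ℝ (Fin n))) (r s : ℝ) : Set (Phase ℂ n) :=
  {z | actions z ∈ complexExt D r ∧ ∀ j, |(angles z j).im| < s}

/-- The complex strip `𝔸ⁿ_s` of width `s` around `𝔸ⁿ = ℝⁿ × 𝕋ⁿ`. -/
def annulusStrip (n : ℕ) (s : ℝ) : Set (Phase ℂ n) :=
  complexDomain (Set.univ : Set (EuclideanSpace ℝ (Fin n))) s s

/-- The character `e^{i k·θ}`. -/
def character {n : ℕ} (k : Fin n → ℤ) (θ : Fin n → ℂ) : ℂ :=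
  Complex.exp (Complex.I * ∑ j, (k j : ℂ) * θ j)

/-- The Fourier coefficient `(2π)⁻ⁿ ∫_{[0,2π]ⁿ} g(I, θ) e^{-i k·θ} dθ`. -/
def angleFourierCoeff {n : ℕ} (g : Phase ℂ n → ℂ) (k : Fin n → ℤ) (I : EuclideanSpace ℂ (Fin n)) :
    ℂ :=
  (((2 * Real.pi) ^ n)⁻¹ : ℝ) *
    ∫ θ in Set.Icc (0 : Fin n → ℝ) (fun _ => 2 * Real.pi),
      g (mkPhase I (fun j => (θ j : ℂ))) * character (-k) (fun j => (θ j : ℂ))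

/-- The weighted Fourier norm `‖g‖_{r,s} = sup_{I ∈ D_r} ∑_k |ĝ_k(I)| e^{|k|₁ s}`. -/
def weightedFourierNorm {n : ℕ} (D : Set (EuclideanSpace ℝ (Fin n))) (r s : ℝ)
    (g : Phase ℂ n → ℂ) : ℝ≥0∞ :=
  ⨆ I ∈ complexExt D r, ∑' k : Fin n → ℤ,
    ‖angleFourierCoeff g k I‖ₑ * ENNReal.ofReal (Real.exp ((∑ j, |(k j : ℝ)|) * s))

/-- On `D`, `g` is a trigonometric polynomial in the angles, with coefficients depending on the
actions: `g(I, θ) = ∑_{k ∈ S} a_k(I) e^{i k·θ}` with `S` finite and independent of `(I, θ)`. -/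
def IsTrigPolynomialOn {n : ℕ} (g : Phase ℂ n → ℂ) (D : Set (Phase ℂ n)) : Prop :=
  ∃ (S : Finset (Fin n → ℤ)) (a : (Fin n → ℤ) → EuclideanSpace ℂ (Fin n) → ℂ),
    ∀ z ∈ D, g z = ∑ k ∈ S, a k (actions z) * character k (angles z)

end Smoothing

end

/-! The smoothing is a convolution. Extend `f` by zero from the box of size `2R` and mollify at
scale `s` in actions and angles with a product of copies of `kern`, the inverse Fourier transform of
an even bump `cutoffC` that is 1 near 0 and supported in `[-1, 1]`. Each property of the bump yields
one property of `f_s`.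

Flatness at 0 makes all moments of `kern` of positive order vanish, so mollification reproduces
polynomials (`integral_taylorPoly_smul_prodKern`). For `x` in the smaller box, let `T` be the Taylor
polynomial of degree `⌊ℓ⌋` at `x`. Then `f - f_s` equals `f - T` minus the mollification of the
extension minus `T`. The first has vanishing derivatives at `x` up to order `⌊ℓ⌋`; the second is
built from a function bounded by a multiple of `‖y - x‖ ^ ℓ` for all `y`, so its derivatives of
order `m` at `x` are of size `s ^ (ℓ - m)` (`norm_iteratedFDeriv_mollify_le`). The jump of the
extension is harmless: it lies at distance at least `min 1 R` from `x`, where boundedness suffices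
(`abs_sub_taylorPoly_le_of_bounded`).

Compact support makes `kern` entire, with quadratic decay in the strip of width one
(`exists_norm_kern_le`). Actions with imaginary part at most `s` become, after division by `s`,
points of that strip, so mollification in the actions continues holomorphically with a bound
independent of `s`. In the angles, mollification multiplies the `k`-th Fourier coefficient by a
factor that vanishes unless `s * |k j| < 2π` for all `j`. Hence `f_s` is a trigonometric polynomial,
and the weight `e^{s|k|₁}` never exceeds `e^{2πn}`. The sum over `k` is then controlled by the
Fourier coefficients of `f` itself, which decay like `‖k‖ ^ (-(n+1))` because `⌊ℓ⌋ ≥ n + 1`, and are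
therefore summable. Evenness of the bump makes `kern` real, hence `f_s` real at real points. -/

open scoped ENNReal
noncomputable section
namespace Smoothing

open Filter Topology Set MeasureTheory

/-! ### Symmetry of iterated derivatives -/

section IteratedDirections

variable {E F : Type*} [NormedAddCommGroup E] [NormedSpace ℝ E] [NormedAddCommGroup F]
  [NormedSpace ℝ F]

/-- The iterated derivative of `f` at `x` along the vectors of a list. -/
def iterDir (f : E → F) (L : List E) (x : E) : F :=
  iteratedFDeriv ℝ L.length f x L.get

theorem iterDir_ofFn (f : E → F) {m : ℕ} (v : Fin m → E) (x : E) :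
    iterDir f (List.ofFn v) x = iteratedFDeriv ℝ m f x v := by
  -- The length of `List.ofFn v` equals `m` only propositionally, so the order of differentiation is
  -- generalised before substituting.
  have key : ∀ (k : ℕ) (h : k = m) (w : Fin k → E), (∀ i, w i = v (Fin.cast h i)) →
      iteratedFDeriv ℝ k f x w = iteratedFDeriv ℝ m f x v := by
    rintro k rfl w hw
    congr 1
    ext1 i
    exact hw i
  exact key _ List.length_ofFn _ (fun i => by simp; rfl)

theorem iterDir_cons {f : E → F} {v : E} {L : List E} {x : E}
    (hf : ContDiffAt ℝ (L.length + 1 : ℕ) f x) :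
    iterDir f (v :: L) x = fderiv ℝ (iterDir f L) x v := by
  have hd : DifferentiableAt ℝ (iteratedFDeriv ℝ L.length f) x :=
    hf.differentiableAt_iteratedFDeriv (by exact_mod_cast Nat.lt_succ_self _)
  have h1 : HasFDerivAt (iterDir f L)
      ((ContinuousMultilinearMap.apply ℝ (fun _ : Fin L.length => E) F L.get).comp
        (fderiv ℝ (iteratedFDeriv ℝ L.length f) x)) x :=
    (ContinuousMultilinearMap.apply ℝ (fun _ : Fin L.length => E) F
      L.get).hasFDerivAt.comp x hd.hasFDerivAt
  rw [h1.fderiv]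
  simp only [iterDir, List.length_cons]
  rw [iteratedFDeriv_succ_apply_left]
  rfl

theorem contDiffAt_iterDir {f : E → F} {L : List E} {x : E} {m : ℕ}
    (hf : ContDiffAt ℝ (L.length + m : ℕ) f x) : ContDiffAt ℝ m (iterDir f L) x := by
  have h1 : ContDiffAt ℝ m (iteratedFDeriv ℝ L.length f) x :=
    hf.iteratedFDeriv_right (by push_cast; rw [add_comm])
  exact (ContinuousMultilinearMap.apply ℝ (fun _ : Fin L.length => E) F
    L.get).contDiff.contDiffAt.comp x h1

/-- Induction on the permutation reduces everything to exchanging the two outermost directions,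
which is the symmetry of the second derivative of `iterDir f l`. Openness of `D` turns equality on
`D` into equality of germs, which can be differentiated. -/
theorem iterDir_perm {f : E → F} {L L' : List E} (h : L.Perm L') {D : Set E} (hD : IsOpen D)
    (hf : ContDiffOn ℝ L.length f D) : ∀ x ∈ D, iterDir f L x = iterDir f L' x := by
  induction h with
  | nil => intro x _; rfl
  | @cons v l l' hp ih =>
    intro x hx
    have hf' : ContDiffAt ℝ (l.length + 1 : ℕ) f x := (hf x hx).contDiffAt (hD.mem_nhds hx)
    rw [iterDir_cons hf', iterDir_cons (hp.length_eq ▸ hf')]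
    have : iterDir f l =ᶠ[𝓝 x] iterDir f l' := by
      filter_upwards [hD.mem_nhds hx] with y hy
      exact ih (hf.of_le (by exact_mod_cast Nat.le_succ _)) y hy
    rw [this.fderiv_eq]
  | swap v w l =>
    intro x hx
    have hf' : ∀ y ∈ D, ContDiffAt ℝ (l.length + 2 : ℕ) f y := fun y hy =>
      (hf y hy).contDiffAt (hD.mem_nhds hy)
    have hcons : ∀ u y, y ∈ D → iterDir f (u :: l) y = fderiv ℝ (iterDir f l) y u :=
      fun u y hy => iterDir_cons ((hf' y hy).of_le (by exact_mod_cast Nat.le_succ _))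
    have h2 : ContDiffAt ℝ 2 (iterDir f l) x := contDiffAt_iterDir (m := 2) (hf' x hx)
    have hdd : DifferentiableAt ℝ (fderiv ℝ (iterDir f l)) x :=
      (h2.fderiv_right (m := 1) (by norm_num)).differentiableAt (by norm_num)
    have step : ∀ u u', iterDir f (u' :: u :: l) x
        = fderiv ℝ (fderiv ℝ (iterDir f l)) x u' u := by
      intro u u'
      rw [iterDir_cons (L := u :: l) (hf' x hx)]
      have : iterDir f (u :: l) =ᶠ[𝓝 x] fun y => fderiv ℝ (iterDir f l) y u := by
        filter_upwards [hD.mem_nhds hx] with y hy using hcons u y hy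
      rw [this.fderiv_eq, fderiv_clm_apply hdd (differentiableAt_const _)]
      simp
    rw [step, step]
    exact (h2.isSymmSndFDerivAt (by simp)) _ _
  | trans h1 h2 ih1 ih2 =>
    intro x hx
    rw [ih1 hf x hx, ih2 (h1.length_eq ▸ hf) x hx]

theorem iteratedFDeriv_comp_perm_of_contDiffOn {f : E → F} {D : Set E} (hD : IsOpen D) {m : ℕ}
    (hf : ContDiffOn ℝ m f D) {x : E} (hx : x ∈ D) (v : Fin m → E) (σ : Equiv.Perm (Fin m)) :
    iteratedFDeriv ℝ m f x (fun i => v (σ i)) = iteratedFDeriv ℝ m f x v := by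
  rw [← iterDir_ofFn, ← iterDir_ofFn]
  refine iterDir_perm ?_ hD (by simpa using hf) x hx
  exact Equiv.Perm.ofFn_comp_perm σ v

end IteratedDirections

/-! ### From partial derivatives to multilinear norms -/

section PartialDerivatives

variable {ι : Type} [Fintype ι] [DecidableEq ι] {F : Type} [NormedAddCommGroup F]
  [NormedSpace ℝ F]

omit [DecidableEq ι] in
theorem length_multiIndexList (α : ι → ℕ) : (multiIndexList α).length = ∑ i, α i := by
  simp [multiIndexList, Multiset.length_toList]

theorem partialDeriv_eq_iterDir (α : ι → ℕ) (f : EuclideanSpace ℝ ι → F)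
    (x : EuclideanSpace ℝ ι) :
    partialDeriv α f x
      = iterDir f ((multiIndexList α).map fun i => EuclideanSpace.single i (1 : ℝ)) x := by
  rw [partialDeriv, ← iterDir_ofFn]
  congr 1
  conv_rhs => rw [← List.ofFn_get (multiIndexList α), List.map_ofFn]
  rfl

theorem multiIndexList_count_perm (l : List ι) :
    (multiIndexList fun i => l.count i).Perm l := by
  rw [← Multiset.coe_eq_coe]
  ext i
  simp [multiIndexList, Multiset.count_sum', Multiset.count_replicate]

/-- The Hölder norm only sees the derivatives `∂^α` with the directions in one chosen order;
symmetry lets it control every mixed derivative. -/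
theorem iteratedFDeriv_single_eq_partialDeriv {f : EuclideanSpace ℝ ι → F}
    {D : Set (EuclideanSpace ℝ ι)} (hD : IsOpen D) {m : ℕ} (hf : ContDiffOn ℝ m f D)
    {x : EuclideanSpace ℝ ι} (hx : x ∈ D) (j : Fin m → ι) :
    iteratedFDeriv ℝ m f x (fun i => EuclideanSpace.single (j i) (1 : ℝ))
      = partialDeriv (fun i => (List.ofFn j).count i) f x := by
  rw [partialDeriv_eq_iterDir, ← iterDir_ofFn]
  symm
  have hp := (multiIndexList_count_perm (List.ofFn j)).map
    (fun i => EuclideanSpace.single i (1 : ℝ))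
  rw [List.map_ofFn] at hp
  refine iterDir_perm hp hD ?_ x hx
  rw [hp.length_eq]
  simpa using hf

theorem sum_count_ofFn {m : ℕ} (j : Fin m → ι) : ∑ i, (List.ofFn j).count i = m := by
  have := length_multiIndexList (fun i => (List.ofFn j).count i)
  rw [← this, (multiIndexList_count_perm _).length_eq, List.length_ofFn]

theorem eq_sum_smul_single (v : EuclideanSpace ℝ ι) :
    v = ∑ i, v i • EuclideanSpace.single i (1 : ℝ) := by
  ext i
  simp [Pi.single_apply]

theorem multilinear_apply_eq_sum {m : ℕ} (A : (EuclideanSpace ℝ ι) [×m]→L[ℝ] F)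
    (v : Fin m → EuclideanSpace ℝ ι) :
    A v = ∑ j : Fin m → ι, (∏ i, v i (j i)) •
      A (fun i => EuclideanSpace.single (j i) (1 : ℝ)) := by
  conv_lhs => rw [show v = fun i => ∑ k, v i k • EuclideanSpace.single k (1 : ℝ) from
    funext fun i => eq_sum_smul_single (v i)]
  rw [A.map_sum]
  refine Finset.sum_congr rfl fun j _ => ?_
  rw [A.map_smul_univ]

/-- The factor counts the `card ι ^ m` terms of the expansion in the standard basis; each coordinate
is at most the Euclidean norm. -/
theorem norm_multilinear_le_of_single {m : ℕ} (A : (EuclideanSpace ℝ ι) [×m]→L[ℝ] F) {M : ℝ}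
    (hM : 0 ≤ M) (h : ∀ j : Fin m → ι, ‖A fun i => EuclideanSpace.single (j i) (1 : ℝ)‖ ≤ M) :
    ‖A‖ ≤ (Fintype.card ι : ℝ) ^ m * M := by
  refine A.opNorm_le_bound (by positivity) fun v => ?_
  rw [multilinear_apply_eq_sum]
  refine (norm_sum_le _ _).trans ?_
  have : ∀ j ∈ (Finset.univ : Finset (Fin m → ι)), ‖(∏ i, v i (j i)) •
      A (fun i => EuclideanSpace.single (j i) (1 : ℝ))‖ ≤ (∏ i, ‖v i‖) * M := by
    intro j _
    rw [norm_smul, norm_prod]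
    refine mul_le_mul (Finset.prod_le_prod (fun _ _ => norm_nonneg _) fun i _ => ?_) (h j)
      (norm_nonneg _) (Finset.prod_nonneg fun _ _ => norm_nonneg _)
    exact PiLp.norm_apply_le (v i) (j i)
  refine (Finset.sum_le_card_nsmul _ _ _ this).trans (le_of_eq ?_)
  simp
  ring

end PartialDerivatives

/-! ### Bounds on derivatives by the Hölder norm -/

section HolderBounds

variable {ι : Type} [Fintype ι] [DecidableEq ι] {F : Type} [NormedAddCommGroup F]
  [NormedSpace ℝ F]

theorem enorm_partialDeriv_le_cNorm {q : ℕ} {D : Set (EuclideanSpace ℝ ι)}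
    {f : EuclideanSpace ℝ ι → F} {α : ι → ℕ} (hα : ∑ i, α i ≤ q) {x : EuclideanSpace ℝ ι}
    (hx : x ∈ D) : ‖partialDeriv α f x‖ₑ ≤ cNorm q D f :=
  le_iSup_of_le α <| le_iSup_of_le hα <| le_iSup₂_of_le x hx le_rfl

theorem cNorm_le_holderNorm {ℓ : ℝ} {D : Set (EuclideanSpace ℝ ι)}
    {f : EuclideanSpace ℝ ι → F} : cNorm ⌊ℓ⌋₊ D f ≤ holderNorm ℓ D f := by
  unfold holderNorm
  split_ifs
  · exact le_rfl
  · exact le_self_add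

theorem norm_partialDeriv_le {ℓ : ℝ} {D : Set (EuclideanSpace ℝ ι)}
    {f : EuclideanSpace ℝ ι → F} (hf : holderNorm ℓ D f < ⊤) {α : ι → ℕ}
    (hα : ∑ i, α i ≤ ⌊ℓ⌋₊) {x : EuclideanSpace ℝ ι} (hx : x ∈ D) :
    ‖partialDeriv α f x‖ ≤ (holderNorm ℓ D f).toReal := by
  have := (enorm_partialDeriv_le_cNorm (f := f) hα hx).trans cNorm_le_holderNorm
  rw [← toReal_enorm]
  exact ENNReal.toReal_mono hf.ne this

/-- The factor 2 merges the two cases of the norm: for integer `ℓ` the exponent is 0 and the bound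
is just the triangle inequality. Integer and fractional `ℓ` need not be separated afterwards. -/
theorem norm_partialDeriv_sub_le {ℓ : ℝ} {D : Set (EuclideanSpace ℝ ι)}
    {f : EuclideanSpace ℝ ι → F} (hf : holderNorm ℓ D f < ⊤) {α : ι → ℕ}
    (hα : ∑ i, α i = ⌊ℓ⌋₊) {x y : EuclideanSpace ℝ ι} (hx : x ∈ D) (hy : y ∈ D)
    (hxy : ‖x - y‖ < 1) :
    ‖partialDeriv α f x - partialDeriv α f y‖
      ≤ 2 * (holderNorm ℓ D f).toReal * ‖x - y‖ ^ Int.fract ℓ := by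
  have hM : 0 ≤ (holderNorm ℓ D f).toReal := ENNReal.toReal_nonneg
  rcases eq_or_ne x y with rfl | hne
  · simp only [sub_self, norm_zero]; positivity
  by_cases h0 : Int.fract ℓ = 0
  · rw [h0, Real.rpow_zero, mul_one, two_mul]
    exact (norm_sub_le _ _).trans (add_le_add (norm_partialDeriv_le hf hα.le hx)
      (norm_partialDeriv_le hf hα.le hy))
  · have hpos : 0 < ‖x - y‖ := norm_pos_iff.2 (sub_ne_zero.2 hne)
    have hp : 0 < ‖x - y‖ ^ Int.fract ℓ := Real.rpow_pos_of_pos hpos _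
    have h1 : ‖partialDeriv α f x - partialDeriv α f y‖ₑ
        / ENNReal.ofReal (‖x - y‖ ^ Int.fract ℓ) ≤ holderNorm ℓ D f := by
      rw [holderNorm, if_neg h0]
      refine le_trans ?_ le_add_self
      exact le_iSup_of_le α <| le_iSup_of_le hα <| le_iSup₂_of_le x hx <|
        le_iSup₂_of_le y hy <| le_iSup_of_le ⟨hpos, hxy⟩ le_rfl
    rw [ENNReal.div_le_iff (by simpa using hp) ENNReal.ofReal_ne_top] at h1
    have h2 := ENNReal.toReal_mono (ENNReal.mul_ne_top hf.ne ENNReal.ofReal_ne_top) h1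
    rw [toReal_enorm, ENNReal.toReal_mul, ENNReal.toReal_ofReal hp.le] at h2
    nlinarith [mul_nonneg hM hp.le]

theorem norm_iteratedFDeriv_le_holderNorm {ℓ : ℝ} {D : Set (EuclideanSpace ℝ ι)} (hD : IsOpen D)
    {f : EuclideanSpace ℝ ι → F} (hf : IsHolder ℓ D f) {m : ℕ} (hm : m ≤ ⌊ℓ⌋₊)
    {x : EuclideanSpace ℝ ι} (hx : x ∈ D) :
    ‖iteratedFDeriv ℝ m f x‖ ≤ (Fintype.card ι : ℝ) ^ m * (holderNorm ℓ D f).toReal := by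
  refine norm_multilinear_le_of_single _ ENNReal.toReal_nonneg fun j => ?_
  rw [iteratedFDeriv_single_eq_partialDeriv hD (hf.1.of_le (by exact_mod_cast hm)) hx]
  exact norm_partialDeriv_le hf.2 (by rwa [sum_count_ofFn]) hx

theorem norm_iteratedFDeriv_sub_le_holderNorm {ℓ : ℝ} {D : Set (EuclideanSpace ℝ ι)}
    (hD : IsOpen D) {f : EuclideanSpace ℝ ι → F} (hf : IsHolder ℓ D f)
    {x y : EuclideanSpace ℝ ι} (hx : x ∈ D) (hy : y ∈ D) (hxy : ‖x - y‖ < 1) :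
    ‖iteratedFDeriv ℝ ⌊ℓ⌋₊ f x - iteratedFDeriv ℝ ⌊ℓ⌋₊ f y‖
      ≤ (Fintype.card ι : ℝ) ^ ⌊ℓ⌋₊ * (2 * (holderNorm ℓ D f).toReal * ‖x - y‖ ^ Int.fract ℓ) := by
  refine norm_multilinear_le_of_single _ (by positivity) fun j => ?_
  rw [sub_apply, iteratedFDeriv_single_eq_partialDeriv hD hf.1 hx,
    iteratedFDeriv_single_eq_partialDeriv hD hf.1 hy]
  exact norm_partialDeriv_sub_le hf.2 (sum_count_ofFn j) hx hy hxy

end HolderBounds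
end Smoothing
end

open scoped ENNReal
noncomputable section
namespace Smoothing

open Filter Topology Set MeasureTheory

/-! ### Taylor polynomials and their remainders -/

section Taylor

variable {E : Type*} [NormedAddCommGroup E] [NormedSpace ℝ E]

theorem iteratedDeriv_comp_line {F : Type*} [NormedAddCommGroup F] [NormedSpace ℝ F] {f : E → F}
    {D : Set E} (hD : IsOpen D) {m : ℕ} (hf : ContDiffOn ℝ m f D) (x v : E) {t : ℝ}
    (ht : x + t • v ∈ D) :
    iteratedDeriv m (fun t : ℝ => f (x + t • v)) t
      = iteratedFDeriv ℝ m f (x + t • v) (fun _ => v) := by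
  induction m generalizing t with
  | zero => simp
  | succ m ih =>
    rw [iteratedDeriv_succ]
    have hc : Continuous fun t : ℝ => x + t • v := by fun_prop
    have hev : iteratedDeriv m (fun t : ℝ => f (x + t • v)) =ᶠ[𝓝 t]
        fun t => iteratedFDeriv ℝ m f (x + t • v) (fun _ => v) := by
      filter_upwards [(hD.preimage hc).mem_nhds ht] with s hs
      exact ih (hf.of_le (by exact_mod_cast Nat.le_succ _)) hs
    rw [hev.deriv_eq]
    have hf' : ContDiffAt ℝ (m + 1 : ℕ) f (x + t • v) :=
      (hf _ ht).contDiffAt (hD.mem_nhds ht)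
    have hd : DifferentiableAt ℝ (iteratedFDeriv ℝ m f) (x + t • v) :=
      hf'.differentiableAt_iteratedFDeriv (by exact_mod_cast Nat.lt_succ_self _)
    have hl : HasDerivAt (fun t : ℝ => x + t • v) v t := by
      simpa using ((hasDerivAt_id t).smul_const v).const_add x
    have h1 : HasDerivAt (fun t : ℝ => iteratedFDeriv ℝ m f (x + t • v))
        (fderiv ℝ (iteratedFDeriv ℝ m f) (x + t • v) v) t :=
      hd.hasFDerivAt.comp_hasDerivAt t hl
    have h2 := (ContinuousMultilinearMap.apply ℝ (fun _ : Fin m => E) F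
      (fun _ => v)).hasFDerivAt.comp_hasDerivAt t h1
    refine h2.deriv.trans ?_
    rw [iteratedFDeriv_succ_apply_left]
    rfl

/-- The Taylor polynomial of degree `q` of `f` at `x`. -/
def taylorPoly (q : ℕ) (f : E → ℝ) (x y : E) : ℝ :=
  ∑ m ∈ Finset.range (q + 1), ((m.factorial : ℝ)⁻¹) * iteratedFDeriv ℝ m f x (fun _ => y - x)

theorem contDiff_taylorPoly (q : ℕ) (f : E → ℝ) (x : E) {r : WithTop ℕ∞} :
    ContDiff ℝ r (taylorPoly q f x) := by
  unfold taylorPoly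
  refine ContDiff.sum fun m _ => contDiff_const.mul ?_
  exact (iteratedFDeriv ℝ m f x).contDiff.comp
    (contDiff_pi.2 fun _ => contDiff_id.sub contDiff_const)

/-- The `m`-th derivative at the centre of a finite power series is the sum of its `m`-th term over
all permutations of the arguments. By symmetry these `m!` summands coincide and cancel the `1 / m!`.
-/
theorem iteratedFDeriv_taylorPoly {q : ℕ} {f : E → ℝ} {D : Set E} (hD : IsOpen D)
    (hf : ContDiffOn ℝ q f D) {x : E} (hx : x ∈ D) {m : ℕ} (hm : m ≤ q) (v : Fin m → E) :
    iteratedFDeriv ℝ m (taylorPoly q f x) x v = iteratedFDeriv ℝ m f x v := by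
  let p : FormalMultilinearSeries ℝ E ℝ := fun k =>
    if k ≤ q then ((k.factorial : ℝ)⁻¹) • iteratedFDeriv ℝ k f x else 0
  have hp : HasFiniteFPowerSeriesOnBall (taylorPoly q f x) p x (q + 1) ⊤ := by
    refine HasFiniteFPowerSeriesOnBall.mk' (fun k hk => ?_) (by simp) fun y _ => ?_
    · exact if_neg (by omega)
    · unfold taylorPoly
      refine Finset.sum_congr rfl fun k hk => ?_
      simp only [p]
      rw [if_pos (by simpa [Nat.lt_succ_iff] using hk)]
      simp
  rw [hp.toHasFPowerSeriesOnBall.iteratedFDeriv_eq_sum_of_completeSpace]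
  have : ∀ σ : Equiv.Perm (Fin m), p m (fun i => v (σ i))
      = ((m.factorial : ℝ)⁻¹) * iteratedFDeriv ℝ m f x v := by
    intro σ
    simp only [p, if_pos hm]
    rw [smul_apply, smul_eq_mul,
      iteratedFDeriv_comp_perm_of_contDiffOn hD (hf.of_le (by exact_mod_cast hm)) hx]
  simp only [this, Finset.sum_const, Finset.card_univ, Fintype.card_perm, Fintype.card_fin,
    nsmul_eq_mul]
  field_simp

/-- Lagrange's remainder is taken for degree `q - 1` along the segment, and the term of degree `q`
at `x` is then subtracted. The remainder becomes a difference of `q`-th derivatives, to which the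
Hölder condition applies; no derivative of order `q + 1` is needed. -/
theorem exists_sub_taylorPoly_eq {q : ℕ} (hq : 1 ≤ q) {f : E → ℝ} {D : Set E} (hD : IsOpen D)
    (hf : ContDiffOn ℝ q f D) {x y : E} (hxy : segment ℝ x y ⊆ D) :
    ∃ t ∈ Ioo (0 : ℝ) 1, f y - taylorPoly q f x y = ((q.factorial : ℝ)⁻¹) *
      (iteratedFDeriv ℝ q f (x + t • (y - x)) (fun _ => y - x)
        - iteratedFDeriv ℝ q f x (fun _ => y - x)) := by
  obtain ⟨k, rfl⟩ : ∃ k, q = k + 1 := ⟨q - 1, by omega⟩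
  have hseg : ∀ t ∈ Icc (0 : ℝ) 1, x + t • (y - x) ∈ D := by
    intro t ht
    apply hxy
    rw [segment_eq_image']
    exact ⟨t, ht, rfl⟩
  set g : ℝ → ℝ := fun t => f (x + t • (y - x)) with hg
  have hgc : ∀ t ∈ Icc (0 : ℝ) 1, ContDiffAt ℝ (k + 1 : ℕ) g t := by
    intro t ht
    have h1 : ContDiffAt ℝ (k + 1 : ℕ) f (x + t • (y - x)) :=
      (hf _ (hseg t ht)).contDiffAt (hD.mem_nhds (hseg t ht))
    exact h1.comp t (by fun_prop)
  have hcd : ContDiffOn ℝ (k + 1) g (uIcc 0 1) := by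
    rw [uIcc_of_le zero_le_one]
    exact fun t ht => (by exact_mod_cast (hgc t ht).contDiffWithinAt)
  obtain ⟨t, ht, h⟩ := taylor_mean_remainder_lagrange_iteratedDeriv (zero_ne_one' ℝ) hcd
  rw [uIoo_of_le zero_le_one] at ht
  refine ⟨t, ht, ?_⟩
  rw [taylor_within_apply] at h
  have hj : ∀ m ≤ k + 1, ∀ t ∈ Icc (0 : ℝ) 1, iteratedDeriv m g t
      = iteratedFDeriv ℝ m f (x + t • (y - x)) (fun _ => y - x) := fun m hm t ht =>
    iteratedDeriv_comp_line hD (hf.of_le (by exact_mod_cast hm)) x _ (hseg t ht)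
  have hz : (0 : ℝ) ∈ Icc (0 : ℝ) 1 := by simp
  have hsum : ∑ m ∈ Finset.range (k + 1), (((m.factorial : ℝ)⁻¹) * (1 - 0) ^ m) •
      iteratedDerivWithin m g (uIcc 0 1) 0
      = ∑ m ∈ Finset.range (k + 1), ((m.factorial : ℝ)⁻¹) *
        iteratedFDeriv ℝ m f x (fun _ => y - x) := by
    refine Finset.sum_congr rfl fun m hm => ?_
    have hm' : m ≤ k + 1 := (Finset.mem_range.1 hm).le
    rw [uIcc_of_le zero_le_one, iteratedDerivWithin_eq_iteratedDeriv
      (uniqueDiffOn_Icc zero_lt_one) ((hgc 0 hz).of_le (by exact_mod_cast hm')) hz, hj m hm' 0 hz]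
    simp
  rw [hsum, hj (k + 1) le_rfl t ⟨ht.1.le, ht.2.le⟩] at h
  have hg1 : g 1 = f y := by simp [hg]
  rw [hg1] at h
  rw [taylorPoly, Finset.sum_range_succ]
  field_simp
  field_simp at h
  simp only [sub_zero, one_pow, mul_one] at h
  linarith

end Taylor

section TaylorBound

variable {ι : Type} [Fintype ι] [DecidableEq ι]

theorem abs_sub_taylorPoly_le {ℓ : ℝ} (hℓ : 1 ≤ ℓ) {D : Set (EuclideanSpace ℝ ι)} (hD : IsOpen D)
    {f : EuclideanSpace ℝ ι → ℝ} (hf : IsHolder ℓ D f) {x y : EuclideanSpace ℝ ι}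
    (hxy : segment ℝ x y ⊆ D) (h1 : ‖y - x‖ < 1) :
    |f y - taylorPoly ⌊ℓ⌋₊ f x y| ≤
      2 * (Fintype.card ι : ℝ) ^ ⌊ℓ⌋₊ * (holderNorm ℓ D f).toReal * ‖y - x‖ ^ ℓ := by
  have hq : 1 ≤ ⌊ℓ⌋₊ := Nat.le_floor (by simpa using hℓ)
  obtain ⟨t, ht, h⟩ := exists_sub_taylorPoly_eq hq hD hf.1 hxy
  have hM : 0 ≤ (holderNorm ℓ D f).toReal := ENNReal.toReal_nonneg
  have hx : x ∈ D := hxy (left_mem_segment _ _ _)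
  have hz : x + t • (y - x) ∈ D := by
    apply hxy
    rw [segment_eq_image']
    exact ⟨t, ⟨ht.1.le, ht.2.le⟩, rfl⟩
  have hd : ‖x + t • (y - x) - x‖ ≤ ‖y - x‖ := by
    rw [add_sub_cancel_left, norm_smul, Real.norm_of_nonneg ht.1.le]
    nlinarith [norm_nonneg (y - x), ht.2]
  have hb := norm_iteratedFDeriv_sub_le_holderNorm hD hf hz hx (hd.trans_lt h1)
  rw [h, ← sub_apply, abs_mul, abs_of_nonneg (by positivity)]
  have hop := (iteratedFDeriv ℝ ⌊ℓ⌋₊ f (x + t • (y - x)) - iteratedFDeriv ℝ ⌊ℓ⌋₊ f x).le_opNorm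
    (fun _ => y - x)
  rw [Finset.prod_const, Finset.card_univ, Fintype.card_fin, Real.norm_eq_abs] at hop
  have hfact : ((⌊ℓ⌋₊.factorial : ℝ)⁻¹) ≤ 1 :=
    inv_le_one_of_one_le₀ (by exact_mod_cast Nat.one_le_iff_ne_zero.2 (Nat.factorial_ne_zero _))
  -- The fractional part of the exponent comes from the Hölder condition, the integer part from the
  -- `⌊ℓ⌋₊` arguments `y - x`.
  have hpow : ‖y - x‖ ^ ℓ = ‖y - x‖ ^ Int.fract ℓ * ‖y - x‖ ^ ⌊ℓ⌋₊ := by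
    rw [← Real.rpow_natCast, ← Real.rpow_add_of_nonneg (norm_nonneg _) (Int.fract_nonneg _)
      (Nat.cast_nonneg _), natCast_floor_eq_intCast_floor (by linarith), Int.fract_add_floor]
  have hr : ‖x + t • (y - x) - x‖ ^ Int.fract ℓ ≤ ‖y - x‖ ^ Int.fract ℓ :=
    Real.rpow_le_rpow (norm_nonneg _) hd (Int.fract_nonneg _)
  calc _ ≤ 1 * |_| := mul_le_mul_of_nonneg_right hfact (abs_nonneg _)
    _ ≤ _ := (one_mul _).le.trans hop
    _ ≤ ((Fintype.card ι : ℝ) ^ ⌊ℓ⌋₊ * (2 * (holderNorm ℓ D f).toReal *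
        ‖y - x‖ ^ Int.fract ℓ)) * ‖y - x‖ ^ ⌊ℓ⌋₊ := by
      refine mul_le_mul_of_nonneg_right (hb.trans ?_) (by positivity)
      gcongr
    _ = _ := by rw [hpow]; ring

/-- The Taylor remainder is bounded by a multiple of the `ℓ`-th power of the distance, globally,
for any bounded extension of `f`. -/
theorem abs_sub_taylorPoly_le_of_bounded {ℓ δ : ℝ} (hℓ : 1 ≤ ℓ) (hδ : 0 < δ) (hδ1 : δ ≤ 1)
    {D : Set (EuclideanSpace ℝ ι)} (hD : IsOpen D) {f g : EuclideanSpace ℝ ι → ℝ}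
    (hf : IsHolder ℓ D f) (hfg : EqOn f g D) (hg : ∀ y, |g y| ≤ (holderNorm ℓ D f).toReal)
    {x : EuclideanSpace ℝ ι} (hx : Metric.ball x δ ⊆ D) (y : EuclideanSpace ℝ ι) :
    |g y - taylorPoly ⌊ℓ⌋₊ f x y| ≤
      (2 * (Fintype.card ι : ℝ) ^ ⌊ℓ⌋₊ + δ ^ (-ℓ) *
        (1 + ∑ m ∈ Finset.range (⌊ℓ⌋₊ + 1), (Fintype.card ι : ℝ) ^ m)) *
        (holderNorm ℓ D f).toReal * ‖y - x‖ ^ ℓ := by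
  set M := (holderNorm ℓ D f).toReal with hMdef
  have hM : 0 ≤ M := ENNReal.toReal_nonneg
  have hxD : x ∈ D := hx (Metric.mem_ball_self hδ)
  rcases lt_or_ge ‖y - x‖ δ with hlt | hge
  · have hy : y ∈ Metric.ball x δ := by rwa [mem_ball_iff_norm]
    have hseg : segment ℝ x y ⊆ D :=
      ((convex_ball x δ).segment_subset (Metric.mem_ball_self hδ) hy).trans hx
    rw [← hfg (hx hy)]
    refine (abs_sub_taylorPoly_le hℓ hD hf hseg (hlt.trans_le hδ1)).trans ?_
    gcongr
    exact le_add_of_nonneg_right (by positivity)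
  -- Far from `x` there is nothing to cancel: since `‖y - x‖ / δ ≥ 1`, both `g` and every term of
  -- the Taylor polynomial are dominated by the power `ℓ`, at the price of `δ ^ (-ℓ)`.
  · have hone : 1 ≤ δ⁻¹ * ‖y - x‖ := by rwa [← div_eq_inv_mul, one_le_div hδ]
    have hpow : ∀ m ≤ ⌊ℓ⌋₊, ‖y - x‖ ^ m ≤ δ ^ (-ℓ) * ‖y - x‖ ^ ℓ := by
      intro m hm
      have h1 : (δ⁻¹ * ‖y - x‖) ^ m ≤ (δ⁻¹ * ‖y - x‖) ^ ℓ := by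
        rw [← Real.rpow_natCast]
        exact Real.rpow_le_rpow_of_exponent_le hone
          ((Nat.cast_le.2 hm).trans (Nat.floor_le (by linarith)))
      rw [Real.mul_rpow (by positivity) (norm_nonneg _), Real.inv_rpow hδ.le,
        ← Real.rpow_neg hδ.le] at h1
      refine le_trans ?_ h1
      exact pow_le_pow_left₀ (norm_nonneg _)
        (le_mul_of_one_le_left (norm_nonneg _) (one_le_inv₀ hδ |>.2 hδ1)) m
    have hP : |taylorPoly ⌊ℓ⌋₊ f x y| ≤
        ∑ m ∈ Finset.range (⌊ℓ⌋₊ + 1), (Fintype.card ι : ℝ) ^ m * M * (δ ^ (-ℓ) * ‖y - x‖ ^ ℓ) := by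
      refine (Finset.abs_sum_le_sum_abs _ _).trans (Finset.sum_le_sum fun m hm => ?_)
      have hm' : m ≤ ⌊ℓ⌋₊ := Nat.lt_succ_iff.1 (Finset.mem_range.1 hm)
      rw [abs_mul, abs_of_nonneg (by positivity)]
      have hfact : ((m.factorial : ℝ)⁻¹) ≤ 1 :=
        inv_le_one_of_one_le₀
          (by exact_mod_cast Nat.one_le_iff_ne_zero.2 (Nat.factorial_ne_zero _))
      have hop := (iteratedFDeriv ℝ m f x).le_opNorm (fun _ => y - x)
      rw [Finset.prod_const, Finset.card_univ, Fintype.card_fin, Real.norm_eq_abs] at hop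
      refine (mul_le_mul_of_nonneg_right hfact (abs_nonneg _)).trans ?_
      rw [one_mul]
      refine hop.trans (mul_le_mul (norm_iteratedFDeriv_le_holderNorm hD hf hm' hxD) (hpow m hm')
        (by positivity) (by positivity))
    have hg' : |g y| ≤ M * (δ ^ (-ℓ) * ‖y - x‖ ^ ℓ) :=
      (hg y).trans (le_mul_of_one_le_right hM (by simpa using hpow 0 (Nat.zero_le _)))
    rw [← Finset.sum_mul, ← Finset.sum_mul] at hP
    have hnn : 0 ≤ 2 * (Fintype.card ι : ℝ) ^ ⌊ℓ⌋₊ * M * ‖y - x‖ ^ ℓ := by positivity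
    calc _ ≤ _ := abs_sub _ _
      _ ≤ _ := add_le_add hg' hP
      _ ≤ _ := le_add_of_nonneg_left hnn
      _ = _ := by ring

end TaylorBound
end Smoothing
end

open scoped ENNReal
noncomputable section
namespace Smoothing

open Filter Topology Set MeasureTheory SchwartzMap
open scoped ContDiff

/-! ### Convolution of rough functions with Schwartz kernels -/

section Convolution

variable {E : Type*} [NormedAddCommGroup E] [NormedSpace ℝ E] [FiniteDimensional ℝ E]
  [MeasurableSpace E] [BorelSpace E] {μ : Measure E} [μ.IsAddHaarMeasure]
  {V : Type*} [NormedAddCommGroup V] [NormedSpace ℝ V]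

/-- `k` decays faster than any power. -/
def RapidDecay (k : E → V) : Prop :=
  ∀ N : ℕ, ∃ B : ℝ, ∀ u, (1 + ‖u‖) ^ N * ‖k u‖ ≤ B

/-- `G` is measurable and grows at most like a power. -/
structure PolyGrowth (μ : Measure E) (G : E → ℝ) : Prop where
  meas : AEStronglyMeasurable G μ
  bound : ∃ (C : ℝ) (Q : ℕ), ∀ u, ‖G u‖ ≤ C * (1 + ‖u‖) ^ Q

omit [FiniteDimensional ℝ E] [MeasurableSpace E] [BorelSpace E] in
theorem rapidDecay_iteratedFDeriv (K : 𝓢(E, V)) (m : ℕ) :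
    RapidDecay (iteratedFDeriv ℝ m K) := fun N =>
  ⟨_, fun u => one_add_le_sup_seminorm_apply (𝕜 := ℝ) (m := (N, m)) le_rfl le_rfl K u⟩

theorem integrable_one_add_norm_inv_pow :
    Integrable (fun u : E => ((1 + ‖u‖) ^ (Module.finrank ℝ E + 1))⁻¹) μ := by
  refine (integrable_one_add_norm (μ := μ) (r := (Module.finrank ℝ E + 1 : ℕ))
    (by push_cast; linarith)).congr (ae_of_all _ fun u => ?_)
  simp only
  rw [Real.rpow_neg (by positivity), Real.rpow_natCast]

omit [FiniteDimensional ℝ E] [MeasurableSpace E] [BorelSpace E] in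
-- From `1 + ‖u‖ ≤ (1 + ‖x‖)(1 + ‖x - u‖)`, decay of `k` in `x - u` becomes decay in `u`, uniformly
-- for bounded `x`. This is the dominating function for differentiation under the integral.
theorem PolyGrowth.bound_mul_shift [MeasurableSpace E] {G : E → ℝ} {k : E → V}
    (hG : ∃ (C : ℝ) (Q : ℕ), ∀ u, ‖G u‖ ≤ C * (1 + ‖u‖) ^ Q) (hk : RapidDecay k) (r : ℝ) :
    ∃ C : ℝ, ∀ x u : E, ‖x‖ ≤ r →
      ‖G u • k (x - u)‖ ≤ C * ((1 + ‖u‖) ^ (Module.finrank ℝ E + 1))⁻¹ := by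
  obtain ⟨C, Q, hC⟩ := hG
  set d := Module.finrank ℝ E + 1
  obtain ⟨B, hB⟩ := hk (Q + d)
  refine ⟨|C| * ((1 + r) ^ (Q + d) * B), fun x u hx => ?_⟩
  rw [← div_eq_mul_inv, le_div_iff₀ (by positivity), norm_smul]
  have hr : 0 ≤ r := (norm_nonneg x).trans hx
  have h1 : 1 + ‖u‖ ≤ (1 + r) * (1 + ‖x - u‖) := by
    have : ‖u‖ ≤ ‖x‖ + ‖x - u‖ := by
      have := norm_sub_le x (x - u)
      rwa [sub_sub_cancel] at this
    nlinarith [norm_nonneg (x - u)]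
  have h2 : (1 + ‖u‖) ^ (Q + d) * ‖k (x - u)‖ ≤ (1 + r) ^ (Q + d) * B := by
    calc _ ≤ ((1 + r) * (1 + ‖x - u‖)) ^ (Q + d) * ‖k (x - u)‖ := by gcongr
      _ = (1 + r) ^ (Q + d) * ((1 + ‖x - u‖) ^ (Q + d) * ‖k (x - u)‖) := by rw [mul_pow]; ring
      _ ≤ _ := by gcongr; exact hB _
  have h3 : ‖G u‖ ≤ |C| * (1 + ‖u‖) ^ Q :=
    (hC u).trans (mul_le_mul_of_nonneg_right (le_abs_self C) (by positivity))
  calc _ ≤ |C| * (1 + ‖u‖) ^ Q * ‖k (x - u)‖ * (1 + ‖u‖) ^ d := by gcongr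
    _ = |C| * ((1 + ‖u‖) ^ (Q + d) * ‖k (x - u)‖) := by rw [pow_add]; ring
    _ ≤ _ := by gcongr

theorem PolyGrowth.integrable_smul_shift {G : E → ℝ} (hG : PolyGrowth μ G) {k : E → V}
    (hk : RapidDecay k) (hc : Continuous k) (x : E) :
    Integrable (fun u => G u • k (x - u)) μ := by
  obtain ⟨C, hC⟩ := PolyGrowth.bound_mul_shift hG.bound hk ‖x‖
  refine (integrable_one_add_norm_inv_pow.const_mul C).mono' ?_ (ae_of_all _ fun u => ?_)
  · exact hG.meas.smul (hc.comp (by fun_prop)).aestronglyMeasurable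
  · exact hC x u le_rfl

theorem PolyGrowth.hasFDerivAt_integral_smul_shift {G : E → ℝ} (hG : PolyGrowth μ G) {k : E → V}
    {k' : E → E →L[ℝ] V} (hkk' : ∀ x, HasFDerivAt k (k' x) x) (hk : RapidDecay k)
    (hk' : RapidDecay k') (hc' : Continuous k') (x : E) :
    HasFDerivAt (fun x => ∫ u, G u • k (x - u) ∂μ) (∫ u, G u • k' (x - u) ∂μ) x := by
  have hc : Continuous k := continuous_iff_continuousAt.2 fun x => (hkk' x).continuousAt
  obtain ⟨C, hC⟩ := PolyGrowth.bound_mul_shift hG.bound hk' (‖x‖ + 1)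
  refine hasFDerivAt_integral_of_dominated_of_fderiv_le (F' := fun x u => G u • k' (x - u))
    (Metric.ball_mem_nhds x one_pos) (Eventually.of_forall fun y =>
      (hG.integrable_smul_shift hk hc y).aestronglyMeasurable)
    (hG.integrable_smul_shift hk hc x) (hG.integrable_smul_shift hk' hc' x).aestronglyMeasurable
    (ae_of_all _ fun u y hy => hC y u ?_) (integrable_one_add_norm_inv_pow.const_mul C)
    (ae_of_all _ fun u y _ => ?_)
  · rw [mem_ball_iff_norm] at hy
    have := norm_sub_norm_le y x
    linarith
  · have := (hkk' (y - u)).comp y ((hasFDerivAt_id y).sub_const u)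
    simpa using! this.const_smul (G u)

/-- All derivatives fall on the kernel, so `G` may be discontinuous and unbounded. It will be
applied to the zero extension minus a Taylor polynomial. -/
theorem PolyGrowth.hasFTaylorSeriesUpTo {G : E → ℝ} (hG : PolyGrowth μ G) [CompleteSpace V]
    (K : 𝓢(E, V)) :
    HasFTaylorSeriesUpTo ∞ (fun x => ∫ u, G u • K (x - u) ∂μ)
      (fun x m => ∫ u, G u • iteratedFDeriv ℝ m K (x - u) ∂μ) := by
  have hcont : ∀ m, Continuous (iteratedFDeriv ℝ m K) := fun m =>
    (K.smooth ⊤).continuous_iteratedFDeriv (by exact_mod_cast le_top)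
  have hint := fun m x =>
    hG.integrable_smul_shift (rapidDecay_iteratedFDeriv K m) (hcont m) x
  have hder : ∀ (m : ℕ) (x : E), HasFDerivAt
      (fun x => ∫ u, G u • iteratedFDeriv ℝ m K (x - u) ∂μ)
      (∫ u, G u • iteratedFDeriv ℝ (m + 1) K (x - u) ∂μ).curryLeft x := by
    intro m x
    have hfd : fderiv ℝ (iteratedFDeriv ℝ m K) = fun y =>
        (continuousMultilinearCurryLeftEquiv ℝ (fun _ : Fin (m + 1) => E) V)
          (iteratedFDeriv ℝ (m + 1) K y) := fderiv_iteratedFDeriv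
    have hd : ∀ y, HasFDerivAt (iteratedFDeriv ℝ m K) (fderiv ℝ (iteratedFDeriv ℝ m K) y) y :=
      fun y => (((K.smooth ⊤).differentiable_iteratedFDeriv
        (by exact_mod_cast ENat.natCast_lt_top m)) y).hasFDerivAt
    have hdec : RapidDecay (fderiv ℝ (iteratedFDeriv ℝ m K)) := by
      intro N
      obtain ⟨B, hB⟩ := rapidDecay_iteratedFDeriv K (m + 1) N
      refine ⟨B, fun u => ?_⟩
      rw [hfd, LinearIsometryEquiv.norm_map]
      exact hB u
    have hc' : Continuous (fderiv ℝ (iteratedFDeriv ℝ m K)) := by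
      rw [hfd]
      exact (LinearIsometryEquiv.continuous _).comp (hcont (m + 1))
    have := hG.hasFDerivAt_integral_smul_shift hd (rapidDecay_iteratedFDeriv K m) hdec hc' x
    convert! this using 1
    have hint' := hG.integrable_smul_shift hdec hc' x
    ext a v
    rw [ContinuousLinearMap.integral_apply hint', ContinuousMultilinearMap.integral_apply
      (hint'.apply_continuousLinearMap a)]
    change (∫ u, G u • iteratedFDeriv ℝ (m + 1) K (x - u) ∂μ) (Fin.cons a v) = _
    rw [ContinuousMultilinearMap.integral_apply (hint (m + 1) x)]
    congr 1
  refine ⟨fun x => ?_, fun m _ x => hder m x, fun m _ => ?_⟩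
  · change (∫ u, G u • iteratedFDeriv ℝ 0 K (x - u) ∂μ) _ = _
    rw [ContinuousMultilinearMap.integral_apply (hint 0 x)]
    simp
  · exact continuous_iff_continuousAt.2 fun x => (hder m x).continuousAt

theorem integrable_rpow_norm_mul_iteratedFDeriv [CompleteSpace V] (K : 𝓢(E, V)) {ℓ : ℝ}
    (hℓ : 0 ≤ ℓ) (m : ℕ) :
    Integrable (fun u => ‖u‖ ^ ℓ * ‖iteratedFDeriv ℝ m K u‖) μ := by
  have hG : PolyGrowth μ (fun u : E => ‖u‖ ^ ℓ) := by
    refine ⟨(by fun_prop : Measurable fun u : E => ‖u‖ ^ ℓ).aestronglyMeasurable, 1, ⌈ℓ⌉₊,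
      fun u => ?_⟩
    rw [Real.norm_of_nonneg (by positivity), one_mul, ← Real.rpow_natCast]
    exact (Real.rpow_le_rpow (norm_nonneg _) (by linarith) hℓ).trans
      (Real.rpow_le_rpow_of_exponent_le (by linarith [norm_nonneg u]) (Nat.le_ceil ℓ))
  have hcont : Continuous (iteratedFDeriv ℝ m K) :=
    (K.smooth ⊤).continuous_iteratedFDeriv (by exact_mod_cast le_top)
  have h := (hG.integrable_smul_shift (rapidDecay_iteratedFDeriv K m) hcont 0).norm
  have h2 := h.comp_neg
  have h3 := hG.integrable_smul_shift (k := fun u => iteratedFDeriv ℝ m K (-u)) (fun N => by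
    obtain ⟨B, hB⟩ := rapidDecay_iteratedFDeriv K m N
    exact ⟨B, fun u => by simpa using hB (-u)⟩) (hcont.comp continuous_neg) 0
  refine h3.norm.congr (ae_of_all _ fun u => ?_)
  simp [norm_smul, abs_of_nonneg (Real.rpow_nonneg (norm_nonneg u) ℓ)]

omit [FiniteDimensional ℝ E] [μ.IsAddHaarMeasure] in
theorem PolyGrowth.comp_smul {G : E → ℝ} (hm : Measurable G) {C : ℝ} {Q : ℕ} (hC : 0 ≤ C)
    (h : ∀ u, ‖G u‖ ≤ C * (1 + ‖u‖) ^ Q) (s : ℝ) : PolyGrowth μ (fun u => G (s • u)) := by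
  refine ⟨(hm.comp (by fun_prop)).aestronglyMeasurable, C * (1 + |s|) ^ Q, Q, fun u => ?_⟩
  refine (h _).trans ?_
  rw [mul_assoc, ← mul_pow, norm_smul, Real.norm_eq_abs]
  gcongr
  nlinarith [abs_nonneg s, norm_nonneg u]

omit [NormedSpace ℝ E] [FiniteDimensional ℝ E] [MeasurableSpace E] [BorelSpace E] in
-- Recasts a remainder bound centred at `x` as polynomial growth about the origin, which makes the
-- mollified remainder well defined.
theorem bound_one_add_of_rpow_bound {G : E → ℝ} {x : E} {ℓ A : ℝ} (hℓ : 0 ≤ ℓ) (hA : 0 ≤ A)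
    (h : ∀ y, |G y| ≤ A * ‖y - x‖ ^ ℓ) (u : E) :
    ‖G u‖ ≤ A * (1 + ‖x‖) ^ ℓ * (1 + ‖u‖) ^ ⌈ℓ⌉₊ := by
  refine (h u).trans ?_
  rw [mul_assoc]
  refine mul_le_mul_of_nonneg_left ?_ hA
  have h1 : ‖u - x‖ ≤ (1 + ‖x‖) * (1 + ‖u‖) := by
    nlinarith [norm_sub_le u x, norm_nonneg u, norm_nonneg x]
  refine (Real.rpow_le_rpow (norm_nonneg _) h1 hℓ).trans ?_
  rw [Real.mul_rpow (by positivity) (by positivity), ← Real.rpow_natCast (1 + ‖u‖)]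
  gcongr
  · linarith [norm_nonneg u]
  · exact Nat.le_ceil ℓ

/-- A function vanishing to order `ℓ` at `x` has, after mollification at scale `s`, derivatives
of order `m` at `x` of size `s ^ (ℓ - m)`. -/
theorem norm_iteratedFDeriv_mollify_le [CompleteSpace V] (K : 𝓢(E, V)) {G : E → ℝ}
    (hm : Measurable G) {x : E} {ℓ A s : ℝ} (hℓ : 0 ≤ ℓ) (hA : 0 ≤ A) (hs : 0 < s)
    (hG : ∀ y, |G y| ≤ A * ‖y - x‖ ^ ℓ) (m : ℕ) :
    ‖iteratedFDeriv ℝ m (fun y => ∫ u, G (s • u) • K (s⁻¹ • y - u) ∂μ) x‖ ≤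
      A * s ^ (ℓ - m) * ∫ u, ‖u‖ ^ ℓ * ‖iteratedFDeriv ℝ m K u‖ ∂μ := by
  have hpg : PolyGrowth μ fun u => G (s • u) :=
    PolyGrowth.comp_smul hm (by positivity) (bound_one_add_of_rpow_bound hℓ hA hG) s
  have hT := hpg.hasFTaylorSeriesUpTo K
  have hcd : ContDiff ℝ m (fun y => ∫ u, G (s • u) • K (y - u) ∂μ) :=
    (HasFTaylorSeriesUpTo.contDiff hT).of_le (by exact_mod_cast le_top)
  -- With the integrand written as `G (s • u) • K (s⁻¹ • y - u)` no Jacobian appears, and `y` enters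
  -- only through `s⁻¹ • y`; each derivative costs exactly one factor `s⁻¹`.
  have h1 := congrFun (iteratedFDeriv_comp_const_smul s⁻¹ hcd) x
  rw [h1, ← hT.eq_iteratedFDeriv (by exact_mod_cast le_top), norm_smul, norm_pow, norm_inv,
    Real.norm_of_nonneg hs.le]
  have hint := (integrable_rpow_norm_mul_iteratedFDeriv (μ := μ) K hℓ m).comp_sub_left (s⁻¹ • x)
  have h2 : ‖∫ u, G (s • u) • iteratedFDeriv ℝ m K (s⁻¹ • x - u) ∂μ‖ ≤
      ∫ u, A * s ^ ℓ * (‖s⁻¹ • x - u‖ ^ ℓ * ‖iteratedFDeriv ℝ m K (s⁻¹ • x - u)‖) ∂μ := by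
    refine norm_integral_le_of_norm_le (hint.const_mul _) (ae_of_all _ fun u => ?_)
    rw [norm_smul, Real.norm_eq_abs]
    refine (mul_le_mul_of_nonneg_right (hG _) (norm_nonneg _)).trans (le_of_eq ?_)
    -- This scaling turns the vanishing of `G` at `x` into the gain `s ^ ℓ`.
    have : ‖s • u - x‖ = s * ‖s⁻¹ • x - u‖ := by
      rw [← Real.norm_of_nonneg hs.le, ← norm_smul, Real.norm_of_nonneg hs.le, smul_sub,
        smul_inv_smul₀ hs.ne', norm_sub_rev]
    rw [this, Real.mul_rpow hs.le (norm_nonneg _)]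
    ring
  rw [integral_const_mul, integral_sub_left_eq_self
    (fun u => ‖u‖ ^ ℓ * ‖iteratedFDeriv ℝ m K u‖) μ (s⁻¹ • x)] at h2
  refine (mul_le_mul_of_nonneg_left h2 (by positivity)).trans (le_of_eq ?_)
  rw [Real.rpow_sub hs, Real.rpow_natCast, inv_pow]
  field_simp

end Convolution
end Smoothing
end

open scoped ENNReal
noncomputable section
namespace Smoothing

open Filter Topology Set MeasureTheory SchwartzMap FourierTransform
open scoped ContDiff

/-! ### The one-dimensional mollifier -/

section Kernel

/-- An even smooth cutoff, equal to one near zero and supported in `[-1, 1]`. -/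
def cutoff : ContDiffBump (0 : ℝ) := ⟨1 / 2, 1, by norm_num, by norm_num⟩

/-- The cutoff as a complex-valued function. -/
def cutoffC (ξ : ℝ) : ℂ := (cutoff ξ : ℂ)

theorem contDiff_cutoffC {r : ℕ∞} : ContDiff ℝ r cutoffC :=
  Complex.ofRealCLM.contDiff.comp cutoff.contDiff

theorem hasCompactSupport_cutoffC : HasCompactSupport cutoffC :=
  cutoff.hasCompactSupport.comp_left (g := ((↑) : ℝ → ℂ)) rfl

theorem cutoffC_neg (ξ : ℝ) : cutoffC (-ξ) = cutoffC ξ := by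
  rw [cutoffC, cutoffC, cutoff.neg]

theorem norm_cutoffC_le_one (ξ : ℝ) : ‖cutoffC ξ‖ ≤ 1 := by
  rw [cutoffC, Complex.norm_real, Real.norm_of_nonneg cutoff.nonneg]
  exact cutoff.le_one

theorem cutoffC_eq_zero {ξ : ℝ} (h : 1 ≤ |ξ|) : cutoffC ξ = 0 := by
  rw [cutoffC, cutoff.zero_of_le_dist (by simpa [cutoff] using h), Complex.ofReal_zero]

theorem abs_le_one_of_mem_tsupport {ξ : ℝ} (h : ξ ∈ tsupport cutoffC) : |ξ| ≤ 1 := by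
  have h1 : tsupport cutoffC ⊆ tsupport cutoff :=
    closure_mono fun η hη h0 => hη (by simp [cutoffC, h0])
  have h2 := h1 h
  rw [cutoff.tsupport_eq] at h2
  simpa [cutoff] using h2

/-- The entire mollifier, the inverse Fourier transform of the cutoff. -/
def kern (z : ℂ) : ℂ := ∫ ξ : ℝ, cutoffC ξ * Complex.exp (2 * Real.pi * Complex.I * z * ξ)

/-- The cutoff as a Schwartz function. -/
def cutoffS : 𝓢(ℝ, ℂ) := hasCompactSupport_cutoffC.toSchwartzMap contDiff_cutoffC

/-- The mollifier on the real line as a Schwartz function. -/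
def kernS : 𝓢(ℝ, ℂ) := 𝓕⁻ cutoffS

theorem kernS_apply (t : ℝ) : kernS t = kern t := by
  rw [kernS, fourierInv_coe, Real.fourierInv_eq']
  refine integral_congr_ae (ae_of_all _ fun ξ => ?_)
  simp only [cutoffS, HasCompactSupport.toSchwartzMap_toFun, smul_eq_mul, RCLike.inner_apply,
    conj_trivial, mul_comm (cutoffC ξ)]
  congr 2
  push_cast
  ring

theorem fourier_kernS (t : ℝ) : 𝓕 (kernS : ℝ → ℂ) t = cutoffC t := by
  rw [← fourier_coe, kernS, FourierTransform.fourier_fourierInv_eq]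
  rfl

theorem integral_kern_mul_exp (t : ℝ) :
    ∫ v : ℝ, kern v * Complex.exp (-(2 * Real.pi * Complex.I * t * v)) = cutoffC t := by
  rw [← fourier_kernS, Real.fourier_real_eq_integral_exp_smul]
  refine integral_congr_ae (ae_of_all _ fun v => ?_)
  simp only [smul_eq_mul, kernS_apply, mul_comm (kern v)]
  congr 2
  push_cast
  ring

/-- Conjugation reverses the frequency, and the cutoff is real and even. -/
theorem conj_kern_ofReal (t : ℝ) : (starRingEnd ℂ) (kern t) = kern t := by
  rw [kern, ← integral_conj, ← integral_neg_eq_self]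
  refine integral_congr_ae (ae_of_all _ fun ξ => ?_)
  simp only [map_mul, ← Complex.exp_conj, Complex.conj_I, Complex.conj_ofReal, cutoffC_neg,
    map_ofNat]
  congr 1
  · simp [cutoffC]
  · congr 1
    push_cast
    ring

theorem integral_deriv_mul_exp {ψ : ℝ → ℂ} (hψ : ContDiff ℝ 1 ψ) (hc : HasCompactSupport ψ)
    (c : ℂ) :
    ∫ ξ : ℝ, deriv ψ ξ * Complex.exp (c * ξ) = -c * ∫ ξ : ℝ, ψ ξ * Complex.exp (c * ξ) := by
  have hexp : ∀ ξ : ℝ, HasDerivAt (fun ξ : ℝ => Complex.exp (c * ξ)) (Complex.exp (c * ξ) * c) ξ :=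
    fun ξ => by
      have := ((hasDerivAt_id (ξ : ℂ)).const_mul c).cexp.comp_ofReal
      simpa using! this
  have hcont : Continuous fun ξ : ℝ => Complex.exp (c * ξ) := by fun_prop
  have hψ' : Continuous (deriv ψ) := hψ.continuous_deriv le_rfl
  have h := integral_mul_deriv_eq_deriv_mul_of_integrable (u := ψ) (u' := deriv ψ)
    (v := fun ξ : ℝ => Complex.exp (c * ξ)) (v' := fun ξ : ℝ => Complex.exp (c * ξ) * c)
    (fun ξ _ => (hψ.differentiable one_ne_zero ξ).hasDerivAt) (fun ξ _ => hexp ξ)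
    ((hψ.continuous.mul (hcont.mul continuous_const)).integrable_of_hasCompactSupport
      hc.mul_right)
    ((hψ'.mul hcont).integrable_of_hasCompactSupport hc.deriv.mul_right)
    ((hψ.continuous.mul hcont).integrable_of_hasCompactSupport hc.mul_right)
  rw [eq_comm, neg_mul, neg_eq_iff_eq_neg, ← h, ← integral_const_mul]
  congr 1
  ext ξ
  ring

theorem norm_integral_mul_exp_le {ψ : ℝ → ℂ} (hψ : Continuous ψ)
    (hs : tsupport ψ ⊆ tsupport cutoffC) {c : ℂ} {b : ℝ} (hb : |c.re| ≤ b) :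
    ‖∫ ξ : ℝ, ψ ξ * Complex.exp (c * ξ)‖ ≤ (∫ ξ : ℝ, ‖ψ ξ‖) * Real.exp b := by
  have hc : HasCompactSupport ψ := hasCompactSupport_cutoffC.of_isClosed_subset
    (isClosed_tsupport ψ) hs
  rw [← integral_mul_const]
  refine norm_integral_le_of_norm_le
    ((hψ.integrable_of_hasCompactSupport hc).norm.mul_const _) (ae_of_all _ fun ξ => ?_)
  rw [norm_mul]
  by_cases h : ψ ξ = 0
  · simp [h]
  refine mul_le_mul_of_nonneg_left ?_ (norm_nonneg _)
  rw [Complex.norm_exp]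
  refine Real.exp_le_exp.2 ?_
  have h1 : |ξ| ≤ 1 := abs_le_one_of_mem_tsupport (hs (subset_tsupport _ h))
  calc (c * ξ).re = c.re * ξ := by simp
    _ ≤ |c.re * ξ| := le_abs_self _
    _ = |c.re| * |ξ| := abs_mul _ _
    _ ≤ b * 1 := by gcongr; exact (abs_nonneg _).trans hb
    _ = b := mul_one b

/-- The mollifier decays quadratically in the strip of width one. -/
theorem exists_norm_kern_le :
    ∃ C : ℝ, 0 < C ∧ ∀ z : ℂ, |z.im| ≤ 1 → ‖kern z‖ ≤ C * (1 + z.re ^ 2)⁻¹ := by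
  have h2 : ContDiff ℝ 2 cutoffC := contDiff_cutoffC
  have h1 : ContDiff ℝ 1 cutoffC := contDiff_cutoffC
  have hd1 : ContDiff ℝ 1 (deriv cutoffC) := h2.deriv'
  have hs1 : tsupport (deriv cutoffC) ⊆ tsupport cutoffC := tsupport_deriv_subset
  have hs2 : tsupport (deriv (deriv cutoffC)) ⊆ tsupport cutoffC :=
    tsupport_deriv_subset.trans hs1
  set A : ℝ := (∫ ξ : ℝ, ‖cutoffC ξ‖) * Real.exp (2 * Real.pi)
  set B : ℝ := (∫ ξ : ℝ, ‖deriv (deriv cutoffC) ξ‖) * Real.exp (2 * Real.pi)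
  have hA : 0 ≤ A := mul_nonneg (integral_nonneg fun _ => norm_nonneg _) (Real.exp_pos _).le
  have hB : 0 ≤ B := mul_nonneg (integral_nonneg fun _ => norm_nonneg _) (Real.exp_pos _).le
  refine ⟨A + B + 1, by positivity, fun z hz => ?_⟩
  set c : ℂ := 2 * Real.pi * Complex.I * z with hc
  have hcre : |c.re| ≤ 2 * Real.pi := by
    have : c.re = -(2 * Real.pi * z.im) := by simp [hc]
    rw [this, abs_neg, abs_mul, abs_of_pos (by positivity)]
    exact mul_le_of_le_one_right (by positivity) hz
  have hk : kern z = ∫ ξ : ℝ, cutoffC ξ * Complex.exp (c * ξ) := rfl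
  have e1 := norm_integral_mul_exp_le h1.continuous Subset.rfl hcre
  have e2 := norm_integral_mul_exp_le (hd1.continuous_deriv le_rfl) hs2 hcre
  -- Two integrations by parts: the transform of the second derivative of the cutoff is `c ^ 2 *
  -- kern z`, so its bound gives decay of order two.
  rw [integral_deriv_mul_exp hd1 hasCompactSupport_cutoffC.deriv,
    integral_deriv_mul_exp h1 hasCompactSupport_cutoffC, ← hk, norm_mul, norm_mul, norm_neg] at e2
  rw [← hk] at e1
  have hcn : ‖c‖ = 2 * Real.pi * ‖z‖ := by
    simp [hc, abs_of_pos Real.pi_pos]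
  have hre : |z.re| ≤ ‖c‖ := by
    rw [hcn]
    refine (Complex.abs_re_le_norm z).trans (le_mul_of_one_le_left (norm_nonneg _) ?_)
    linarith [Real.pi_gt_three]
  rw [← div_eq_mul_inv, le_div_iff₀ (by positivity)]
  have hsq : z.re ^ 2 ≤ ‖c‖ * ‖c‖ := by
    rw [← sq_abs, sq]
    exact mul_self_le_mul_self (abs_nonneg _) hre
  have := mul_le_mul_of_nonneg_right hsq (norm_nonneg (kern z))
  nlinarith [norm_nonneg (kern z)]

theorem continuous_kern_ofReal : Continuous fun t : ℝ => kern t := by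
  simpa only [← kernS_apply] using kernS.continuous

theorem integrable_pow_mul_kern (a : ℕ) : Integrable fun t : ℝ => (t : ℂ) ^ a * kern t := by
  have h := kernS.integrable_pow_mul volume a
  refine h.mono' ((by fun_prop : Continuous fun t : ℝ => (t : ℂ) ^ a).mul
    continuous_kern_ofReal).aestronglyMeasurable (ae_of_all _ fun t => ?_)
  rw [← kernS_apply, norm_mul, norm_pow, Complex.norm_real]

/-- Up to a power of `-2πi`, moments are derivatives at 0 of the Fourier transform, which is
identically 1 near 0. -/
theorem integral_pow_mul_kern (a : ℕ) :
    ∫ t : ℝ, (t : ℂ) ^ a * kern t = if a = 0 then 1 else 0 := by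
  have hint : ∀ b : ℕ, (b : ℕ∞) ≤ ⊤ → Integrable fun t : ℝ => t ^ b • kernS t := fun b _ => by
    refine (integrable_pow_mul_kern b).congr (ae_of_all _ fun t => ?_)
    simp [kernS_apply]
  have h := congrFun (Real.iteratedDeriv_fourier (n := a) hint le_top) 0
  have h1 : 𝓕 (kernS : ℝ → ℂ) =ᶠ[𝓝 0] fun _ => (1 : ℂ) := by
    filter_upwards [cutoff.eventuallyEq_one] with t ht
    rw [fourier_kernS, cutoffC, ht]
    simp
  rw [h1.iteratedDeriv_eq, iteratedDeriv_const, Real.fourier_real_eq_integral_exp_smul] at h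
  have h2 : (-2 * Real.pi * Complex.I : ℂ) ^ a * ∫ t : ℝ, (t : ℂ) ^ a * kern t
      = if a = 0 then 1 else 0 := by
    rw [h, ← integral_const_mul]
    refine integral_congr_ae (ae_of_all _ fun t => ?_)
    simp only [mul_zero, Complex.ofReal_zero, zero_mul, Complex.exp_zero, smul_eq_mul,
      kernS_apply, mul_pow]
    ring
  have hne : (-2 * Real.pi * Complex.I : ℂ) ^ a ≠ 0 := pow_ne_zero _ (by simp [Real.pi_ne_zero])
  split_ifs at h2 ⊢ with ha
  · simpa [ha] using h2
  · exact (mul_eq_zero.1 h2).resolve_left hne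

theorem integrable_sub_pow_mul_kern (w s : ℝ) (a : ℕ) :
    Integrable fun t : ℝ => ((w - s * t : ℝ) : ℂ) ^ a * kern t := by
  have : (fun t : ℝ => ((w - s * t : ℝ) : ℂ) ^ a * kern t) = fun t : ℝ =>
      ∑ b ∈ Finset.range (a + 1), ((-s : ℂ) ^ b * (w : ℂ) ^ (a - b) * (a.choose b)) *
        ((t : ℂ) ^ b * kern t) := by
    ext t
    rw [show ((w - s * t : ℝ) : ℂ) = -s * t + w by push_cast; ring, add_pow, Finset.sum_mul]
    refine Finset.sum_congr rfl fun b _ => ?_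
    rw [mul_pow]
    ring
  rw [this]
  exact integrable_finsetSum _ fun b _ => (integrable_pow_mul_kern b).const_mul _

/-- In the binomial expansion in `t` only the zeroth moment survives. -/
theorem integral_sub_pow_mul_kern (w s : ℝ) (a : ℕ) :
    ∫ t : ℝ, ((w - s * t : ℝ) : ℂ) ^ a * kern t = (w : ℂ) ^ a := by
  have : (fun t : ℝ => ((w - s * t : ℝ) : ℂ) ^ a * kern t) = fun t : ℝ =>
      ∑ b ∈ Finset.range (a + 1), ((-s : ℂ) ^ b * (w : ℂ) ^ (a - b) * (a.choose b)) *
        ((t : ℂ) ^ b * kern t) := by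
    ext t
    rw [show ((w - s * t : ℝ) : ℂ) = -s * t + w by push_cast; ring, add_pow, Finset.sum_mul]
    refine Finset.sum_congr rfl fun b _ => ?_
    rw [mul_pow]
    ring
  rw [this, integral_finsetSum _ fun b _ => (integrable_pow_mul_kern b).const_mul _]
  simp only [integral_const_mul, integral_pow_mul_kern]
  rw [Finset.sum_eq_single 0]
  · simp
  · intro b _ hb
    simp [hb]
  · simp

end Kernel

/-! ### The product mollifier and reproduction of polynomials -/

section ProductKernel

variable {ι : Type} [Fintype ι]

theorem integral_euclidean_prod (g : ι → ℝ → ℂ) :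
    ∫ u : EuclideanSpace ℝ ι, ∏ i, g i (u i) = ∏ i, ∫ t : ℝ, g i t := by
  rw [← integral_fintype_prod_volume_eq_prod,
    ← (PiLp.volume_preserving_toLp ι).integral_comp
      (MeasurableEquiv.toLp 2 (ι → ℝ)).measurableEmbedding]

theorem integrable_euclidean_prod {g : ι → ℝ → ℂ} (hg : ∀ i, Integrable (g i)) :
    Integrable fun u : EuclideanSpace ℝ ι => ∏ i, g i (u i) := by
  rw [← (PiLp.volume_preserving_toLp ι).integrable_comp_emb
    (MeasurableEquiv.toLp 2 (ι → ℝ)).measurableEmbedding]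
  exact Integrable.fintype_prod hg

/-- The product cutoff. -/
def prodCutoff (ι : Type) [Fintype ι] : 𝓢(EuclideanSpace ℝ ι, ℂ) :=
  HasCompactSupport.toSchwartzMap (f := fun u : EuclideanSpace ℝ ι => ∏ i, cutoffC (u i))
    (HasCompactSupport.intro
      (K := WithLp.toLp 2 '' (Set.univ.pi fun _ : ι => Set.Icc (-1 : ℝ) 1))
      ((isCompact_univ_pi fun _ => isCompact_Icc).image (PiLp.continuous_toLp 2 _)) (by
        intro u hu
        by_contra h
        refine hu ⟨u.ofLp, fun i _ => abs_le.1 ?_, rfl⟩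
        rw [← ne_eq, Finset.prod_ne_zero_iff] at h
        by_contra hlt
        exact h i (Finset.mem_univ i) (cutoffC_eq_zero (not_le.1 hlt).le)))
    (contDiff_prod fun i _ => contDiff_cutoffC.comp (contDiff_piLp_apply (p := 2)))

/-- The product mollifier. -/
def prodKern (ι : Type) [Fintype ι] : 𝓢(EuclideanSpace ℝ ι, ℂ) := 𝓕⁻ (prodCutoff ι)

theorem prodKern_apply (u : EuclideanSpace ℝ ι) : prodKern ι u = ∏ i, kern (u i) := by
  rw [prodKern, fourierInv_coe, Real.fourierInv_eq']
  simp only [kern]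
  rw [← integral_euclidean_prod]
  refine integral_congr_ae (ae_of_all _ fun v => ?_)
  simp only [prodCutoff, HasCompactSupport.toSchwartzMap_toFun, smul_eq_mul,
    Finset.prod_mul_distrib, ← Complex.exp_sum]
  rw [mul_comm]
  congr 2
  simp only [PiLp.inner_apply, RCLike.inner_apply, conj_trivial]
  push_cast
  rw [Finset.mul_sum, Finset.sum_mul]
  refine Finset.sum_congr rfl fun i _ => ?_
  ring

variable [DecidableEq ι]

/-- Grouping the factors by the coordinate they use, that is by the fibres of `j`, separates the
variables, so that Fubini reduces to one-dimensional moments. -/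
theorem monomial_mul_prodKern {m : ℕ} (j : Fin m → ι) (w u : EuclideanSpace ℝ ι) (s : ℝ) :
    ((∏ i, (w - s • u) (j i) : ℝ) : ℂ) * prodKern ι u
      = ∏ c, ((w c - s * u c : ℝ) : ℂ) ^ (Finset.univ.filter fun i => j i = c).card *
        kern (u c) := by
  rw [Finset.prod_mul_distrib, prodKern_apply]
  congr 1
  rw [Complex.ofReal_prod,
    ← Finset.prod_fiberwise' Finset.univ j fun c => (((w - s • u) c : ℝ) : ℂ)]
  refine Finset.prod_congr rfl fun c _ => ?_
  rw [Finset.prod_const]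
  simp

theorem integrable_monomial_mul_prodKern {m : ℕ} (j : Fin m → ι) (w : EuclideanSpace ℝ ι)
    (s : ℝ) :
    Integrable fun u => ((∏ i, (w - s • u) (j i) : ℝ) : ℂ) * prodKern ι u := by
  simp only [monomial_mul_prodKern]
  exact integrable_euclidean_prod (g := fun c t => ((w c - s * t : ℝ) : ℂ) ^
    (Finset.univ.filter fun i => j i = c).card * kern t)
    fun c => integrable_sub_pow_mul_kern _ _ _

theorem integral_monomial_mul_prodKern {m : ℕ} (j : Fin m → ι) (w : EuclideanSpace ℝ ι)
    (s : ℝ) :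
    ∫ u, ((∏ i, (w - s • u) (j i) : ℝ) : ℂ) * prodKern ι u = ((∏ i, w (j i) : ℝ) : ℂ) := by
  simp only [monomial_mul_prodKern]
  rw [integral_euclidean_prod (fun c t => ((w c - s * t : ℝ) : ℂ) ^
    (Finset.univ.filter fun i => j i = c).card * kern t)]
  simp only [integral_sub_pow_mul_kern]
  rw [Complex.ofReal_prod, ← Finset.prod_fiberwise' Finset.univ j fun c => (w c : ℂ)]
  simp [Finset.prod_const]

/-- Mollification reproduces polynomials. -/
theorem integral_taylorPoly_smul_prodKern (q : ℕ) (f : EuclideanSpace ℝ ι → ℝ)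
    (x y : EuclideanSpace ℝ ι) (s : ℝ) :
    ∫ u, taylorPoly q f x (y - s • u) • prodKern ι u = (taylorPoly q f x y : ℂ) := by
  have key : ∀ z, (taylorPoly q f x z : ℂ) = ∑ m ∈ Finset.range (q + 1), ∑ j : Fin m → ι,
      ((m.factorial : ℂ)⁻¹ * (iteratedFDeriv ℝ m f x
        (fun i => EuclideanSpace.single (j i) (1 : ℝ)) : ℂ)) *
        ((∏ i, (z - x) (j i) : ℝ) : ℂ) := by
    intro z
    rw [taylorPoly, Complex.ofReal_sum]
    refine Finset.sum_congr rfl fun m _ => ?_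
    rw [multilinear_apply_eq_sum, Finset.mul_sum, Complex.ofReal_sum]
    refine Finset.sum_congr rfl fun j _ => ?_
    rw [smul_eq_mul]
    push_cast
    ring
  have hsub : ∀ u : EuclideanSpace ℝ ι, y - s • u - x = (y - x) - s • u := fun u => by abel
  simp only [Complex.real_smul, key, Finset.sum_mul, hsub, mul_assoc]
  have hint : ∀ (m : ℕ) (j : Fin m → ι), Integrable fun u : EuclideanSpace ℝ ι =>
      (m.factorial : ℂ)⁻¹ * ((iteratedFDeriv ℝ m f x
        (fun i => EuclideanSpace.single (j i) (1 : ℝ)) : ℂ) *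
        (((∏ i, ((y - x) - s • u) (j i) : ℝ) : ℂ) * prodKern ι u)) := fun m j =>
    ((integrable_monomial_mul_prodKern j (y - x) s).const_mul _).const_mul _
  rw [integral_finsetSum _ fun m _ => integrable_finsetSum _ fun j _ => hint m j]
  refine Finset.sum_congr rfl fun m _ => ?_
  rw [integral_finsetSum _ fun j _ => hint m j]
  refine Finset.sum_congr rfl fun j _ => ?_
  rw [integral_const_mul, integral_const_mul, integral_monomial_mul_prodKern]

end ProductKernel
end Smoothing
end

open scoped ENNReal
noncomputable section
namespace Smoothing

open Filter Topology Set MeasureTheory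

/-! ### Fourier coefficients on the torus -/

section Torus

variable {ι : Type} [Fintype ι]

/-- `g` is `2πℤ`-periodic in each coordinate. -/
def TwoPiPeriodic (g : (ι → ℝ) → ℂ) : Prop :=
  ∀ (θ : ι → ℝ) (m : ι → ℤ), g (fun j => θ j + 2 * Real.pi * m j) = g θ

/-- The Haar probability measure of the torus. -/
def torusMeasure (ι : Type) [Fintype ι] : Measure (UnitAddTorus ι) :=
  Measure.pi fun _ => AddCircle.haarAddCircle

instance : IsProbabilityMeasure (torusMeasure ι) := by
  unfold torusMeasure; infer_instance

instance : (torusMeasure ι).IsAddHaarMeasure := by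
  unfold torusMeasure; infer_instance

/-- The representative in `[0, 2π)ⁿ` of a point of the torus. -/
def torusRep (t : UnitAddTorus ι) : ι → ℝ :=
  fun j => 2 * Real.pi * (AddCircle.equivIco 1 0 (t j) : ℝ)

/-- The projection of angles to the torus. -/
def torusMk (θ : ι → ℝ) : UnitAddTorus ι := fun j => ((θ j / (2 * Real.pi) : ℝ) : UnitAddCircle)

omit [Fintype ι] in
theorem measurable_torusRep : Measurable (torusRep : UnitAddTorus ι → ι → ℝ) :=
  measurable_pi_lambda _ fun j => (measurable_subtype_coe.comp
    ((AddCircle.measurableEquivIco 1 0).measurable.comp (measurable_pi_apply j))).const_mul _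

omit [Fintype ι] in
theorem torusMk_torusRep (t : UnitAddTorus ι) : torusMk (torusRep t) = t := by
  ext j
  simp only [torusMk, torusRep]
  rw [mul_div_cancel_left₀ _ (by positivity)]
  exact AddCircle.coe_equivIco

omit [Fintype ι] in
theorem torusMk_add (θ η : ι → ℝ) : torusMk (θ + η) = torusMk θ + torusMk η := by
  ext j
  simp [torusMk, add_div]

omit [Fintype ι] in
theorem TwoPiPeriodic.apply_torusRep {g : (ι → ℝ) → ℂ} (hg : TwoPiPeriodic g) (θ : ι → ℝ) :
    g (torusRep (torusMk θ)) = g θ := by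
  have h : ∀ j, ∃ m : ℤ, torusRep (torusMk θ) j = θ j + 2 * Real.pi * m := by
    intro j
    have h1 := congrFun (torusMk_torusRep (torusMk θ)) j
    simp only [torusMk] at h1
    rw [← sub_eq_zero, ← AddCircle.coe_sub, AddCircle.coe_eq_zero_iff] at h1
    obtain ⟨m, hm⟩ := h1
    refine ⟨m, ?_⟩
    have hp : (2 * Real.pi) ≠ 0 := by positivity
    rw [zsmul_eq_mul, mul_one, ← sub_div, eq_div_iff hp] at hm
    linear_combination -hm
  choose m hm using h
  rw [← hg θ m]
  congr 1
  ext j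
  exact hm j

omit [Fintype ι] in
theorem isOpenQuotientMap_torusMk : IsOpenQuotientMap (torusMk : (ι → ℝ) → UnitAddTorus ι) := by
  have h1 : IsOpenQuotientMap (Pi.map fun (_ : ι) (x : ℝ) => (x : UnitAddCircle)) :=
    IsOpenQuotientMap.piMap fun _ => QuotientAddGroup.isOpenQuotientMap_mk
  have h2 : IsOpenQuotientMap (Pi.map fun (_ : ι) (x : ℝ) => x * (2 * Real.pi)⁻¹) :=
    IsOpenQuotientMap.piMap fun _ =>
      (Homeomorph.mulRight₀ (2 * Real.pi)⁻¹ (by positivity)).isOpenQuotientMap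
  convert! h1.comp h2 using 1

/-- The function on the torus defined by a periodic function of the angles. -/
def torusLift (g : (ι → ℝ) → ℂ) (t : UnitAddTorus ι) : ℂ := g (torusRep t)

omit [Fintype ι] in
theorem TwoPiPeriodic.torusLift_torusMk {g : (ι → ℝ) → ℂ} (hg : TwoPiPeriodic g) (θ : ι → ℝ) :
    torusLift g (torusMk θ) = g θ := hg.apply_torusRep θ

omit [Fintype ι] in
-- The representative `torusRep` jumps, so continuity is obtained by descending `g` along the
-- quotient map `torusMk`.
theorem TwoPiPeriodic.continuous_torusLift {g : (ι → ℝ) → ℂ} (hg : TwoPiPeriodic g)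
    (hc : Continuous g) : Continuous (torusLift g) := by
  rw [isOpenQuotientMap_torusMk.isQuotientMap.continuous_iff]
  exact hc.congr fun θ => (hg.torusLift_torusMk θ).symm

/-- The Fourier coefficients of a periodic function of the angles. -/
def angleCoeff (g : (ι → ℝ) → ℂ) (k : ι → ℤ) : ℂ := UnitAddTorus.mFourierCoeff (torusLift g) k

theorem angleCoeff_eq (g : (ι → ℝ) → ℂ) (k : ι → ℤ) :
    angleCoeff g k = ∫ t, UnitAddTorus.mFourier (-k) t * g (torusRep t) ∂(torusMeasure ι) := rfl

theorem norm_angleCoeff_le {g : (ι → ℝ) → ℂ} {M : ℝ} (h : ∀ θ, ‖g θ‖ ≤ M) (k : ι → ℤ) :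
    ‖angleCoeff g k‖ ≤ M := by
  rw [angleCoeff_eq]
  refine (norm_integral_le_of_norm_le_const (C := M) (ae_of_all _ fun t => ?_)).trans (by simp)
  rw [norm_mul]
  have h1 : ‖UnitAddTorus.mFourier (-k) t‖ ≤ 1 :=
    ((UnitAddTorus.mFourier (-k)).norm_coe_le_norm t).trans UnitAddTorus.mFourier_norm.le
  exact (mul_le_of_le_one_left (norm_nonneg _) h1).trans (h _)

theorem mFourier_torusMk (k : ι → ℤ) (θ : ι → ℝ) :
    UnitAddTorus.mFourier k (torusMk θ) = Complex.exp (Complex.I * ∑ j, (k j : ℂ) * θ j) := by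
  simp only [UnitAddTorus.mFourier, torusMk, ContinuousMap.coe_mk]
  rw [Finset.mul_sum, Complex.exp_sum]
  refine Finset.prod_congr rfl fun j _ => ?_
  rw [fourier_coe_apply]
  congr 1
  have : (Real.pi : ℂ) ≠ 0 := by exact_mod_cast Real.pi_ne_zero
  push_cast
  field_simp

theorem mFourier_add_apply (k : ι → ℤ) (t a : UnitAddTorus ι) :
    UnitAddTorus.mFourier k (t + a) = UnitAddTorus.mFourier k t * UnitAddTorus.mFourier k a := by
  rw [← torusMk_torusRep t, ← torusMk_torusRep a, ← torusMk_add, mFourier_torusMk,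
    mFourier_torusMk, mFourier_torusMk, ← Complex.exp_add]
  congr 1
  simp only [Pi.add_apply, Complex.ofReal_add, mul_add, Finset.sum_add_distrib]

omit [Fintype ι] in
theorem TwoPiPeriodic.shift {g : (ι → ℝ) → ℂ} (hg : TwoPiPeriodic g) (v : ι → ℝ) :
    TwoPiPeriodic fun θ => g (θ + v) := by
  intro θ m
  refine Eq.trans ?_ (hg (θ + v) m)
  change g _ = g _
  congr 1
  ext j
  simp only [Pi.add_apply]
  ring

/-- Translation invariance of Haar measure, with the multiplicativity of the characters. -/
theorem TwoPiPeriodic.angleCoeff_shift {g : (ι → ℝ) → ℂ} (hg : TwoPiPeriodic g) (v : ι → ℝ)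
    (k : ι → ℤ) :
    angleCoeff (fun θ => g (θ + v)) k
      = Complex.exp (Complex.I * ∑ j, (k j : ℂ) * v j) * angleCoeff g k := by
  have h1 : ∀ t : UnitAddTorus ι, g (torusRep t + v) = torusLift g (t + torusMk v) := by
    intro t
    rw [← hg.torusLift_torusMk, torusMk_add, torusMk_torusRep]
  have h2 : ∀ t : UnitAddTorus ι, UnitAddTorus.mFourier (-k) t * torusLift g (t + torusMk v)
      = Complex.exp (Complex.I * ∑ j, (k j : ℂ) * v j) *
        (UnitAddTorus.mFourier (-k) (t + torusMk v) * torusLift g (t + torusMk v)) := by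
    intro t
    rw [mFourier_add_apply, mFourier_torusMk]
    have : Complex.exp (Complex.I * ∑ j, (k j : ℂ) * v j) *
        Complex.exp (Complex.I * ∑ j, (((-k) j : ℤ) : ℂ) * v j) = 1 := by
      rw [← Complex.exp_add, ← mul_add, ← Finset.sum_add_distrib]
      simp
    linear_combination (-(UnitAddTorus.mFourier (-k) t * torusLift g (t + torusMk v))) * this
  rw [angleCoeff_eq, angleCoeff_eq, ← integral_const_mul]
  simp only [h1, h2]
  exact integral_add_right_eq_self (μ := torusMeasure ι) (fun t =>
    Complex.exp (Complex.I * ∑ j, (k j : ℂ) * v j) *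
        (UnitAddTorus.mFourier (-k) t * torusLift g t)) (torusMk v)

theorem TwoPiPeriodic.integrable {g : (ι → ℝ) → ℂ} (hg : TwoPiPeriodic g) (hc : Continuous g)
    (k : ι → ℤ) :
    Integrable (fun t => UnitAddTorus.mFourier (-k) t * g (torusRep t)) (torusMeasure ι) := by
  have := ((UnitAddTorus.mFourier (-k)).continuous.mul
    (hg.continuous_torusLift hc)).continuousOn.integrableOn_compact
      (μ := torusMeasure ι) isCompact_univ
  rwa [integrableOn_univ] at this

omit [Fintype ι] in
theorem TwoPiPeriodic.fwdDiff {g : (ι → ℝ) → ℂ} (hg : TwoPiPeriodic g) (v : ι → ℝ) :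
    TwoPiPeriodic (fwdDiff v g) := by
  intro θ m
  have h := hg.shift v θ m
  simp only [_root_.fwdDiff, hg θ m] at h ⊢
  rw [h]

omit [Fintype ι] in
theorem continuous_fwdDiff {g : (ι → ℝ) → ℂ} (hc : Continuous g) (v : ι → ℝ) :
    Continuous (fwdDiff v g) :=
  (hc.comp (continuous_id.add continuous_const)).sub hc

/-- Differencing with a shift that negates the `k`-th character doubles the coefficient. -/
theorem TwoPiPeriodic.angleCoeff_fwdDiff_iterate {g : (ι → ℝ) → ℂ} (hg : TwoPiPeriodic g)
    (hc : Continuous g) {v : ι → ℝ} {k : ι → ℤ}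
    (hv : Complex.exp (Complex.I * ∑ j, (k j : ℂ) * v j) = -1) (m : ℕ) :
    angleCoeff ((_root_.fwdDiff v)^[m] g) k = (-2) ^ m * angleCoeff g k := by
  induction m generalizing g with
  | zero => simp
  | succ m ih =>
    rw [Function.iterate_succ_apply, ih (hg.fwdDiff v) (continuous_fwdDiff hc v)]
    have : angleCoeff (_root_.fwdDiff v g) k
        = angleCoeff (fun θ => g (θ + v)) k - angleCoeff g k := by
      simp only [angleCoeff_eq, _root_.fwdDiff, mul_sub]
      exact integral_sub ((hg.shift v).integrable
        (hc.comp (continuous_id.add continuous_const)) k) (hg.integrable hc k)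
    rw [this, hg.angleCoeff_shift, hv]
    ring

/-- By the mean value inequality, one difference trades one derivative for a factor `|h|`; the
induction replaces `φ` by its difference and `M` by `|h| * M`. -/
theorem norm_fwdDiff_iterate_le {m : ℕ} {φ : ℝ → ℂ} (hφ : ContDiff ℝ m φ) {M : ℝ}
    (hM : ∀ t, ‖iteratedDeriv m φ t‖ ≤ M) (h t : ℝ) :
    ‖(fwdDiff h)^[m] φ t‖ ≤ |h| ^ m * M := by
  induction m generalizing φ M with
  | zero => simpa using hM t
  | succ m ih =>
    rw [Function.iterate_succ_apply]
    have hφm : ContDiff ℝ m φ := hφ.of_le (by exact_mod_cast Nat.le_succ m)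
    have hsh : ContDiff ℝ m fun t => φ (t + h) := hφm.comp (contDiff_id.add contDiff_const)
    have hcd : ContDiff ℝ m (fwdDiff h φ) := hsh.sub hφm
    have := ih (M := |h| * M) hcd fun t => by
      have e : iteratedDeriv m (fwdDiff h φ) t
          = iteratedDeriv m φ (t + h) - iteratedDeriv m φ t := by
        change iteratedDeriv m (fun t => φ (t + h) - φ t) t = _
        rw [iteratedDeriv_fun_sub hsh.contDiffAt hφm.contDiffAt, iteratedDeriv_comp_add_const]
      rw [e]
      have hd : Differentiable ℝ (iteratedDeriv m φ) :=
        hφ.differentiable_iteratedDeriv m (by exact_mod_cast Nat.lt_succ_self m)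
      have := Convex.norm_image_sub_le_of_norm_deriv_le (s := Set.univ) (x := t) (y := t + h)
        (C := M) (fun x _ => hd x) (fun x _ => by rw [← iteratedDeriv_succ]; exact hM x)
        convex_univ (mem_univ _) (mem_univ _)
      simpa [mul_comm] using this
    refine this.trans (le_of_eq ?_)
    ring

omit [Fintype ι] in
theorem fwdDiff_iterate_line (g : (ι → ℝ) → ℂ) (e θ : ι → ℝ) (h t : ℝ) (m : ℕ) :
    (fwdDiff (h • e))^[m] g (θ + t • e) = (fwdDiff h)^[m] (fun t : ℝ => g (θ + t • e)) t := by
  induction m generalizing g t with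
  | zero => rfl
  | succ m ih =>
    rw [Function.iterate_succ_apply', Function.iterate_succ_apply', fwdDiff, fwdDiff, ← ih, ← ih,
      add_smul, add_assoc]

/-- Decay of the Fourier coefficients of a periodic function with `m` bounded derivatives. -/
theorem TwoPiPeriodic.norm_angleCoeff_le_of_deriv [DecidableEq ι] {g : (ι → ℝ) → ℂ}
    (hg : TwoPiPeriodic g) (hc : Continuous g) {m : ℕ} {M : ℝ} {j : ι}
    (hcd : ∀ θ : ι → ℝ, ContDiff ℝ m fun t : ℝ => g (θ + t • Pi.single j 1))
    (hM : ∀ (θ : ι → ℝ) (t : ℝ),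
      ‖iteratedDeriv m (fun t : ℝ => g (θ + t • Pi.single j 1)) t‖ ≤ M)
    {k : ι → ℤ} (hk : k j ≠ 0) :
    ‖angleCoeff g k‖ ≤ (Real.pi / 2 * |(k j : ℝ)|⁻¹) ^ m * M := by
  have hk' : (k j : ℝ) ≠ 0 := by exact_mod_cast hk
  -- A shift by half a wavelength in direction `j` changes the sign of the `k`-th character.
  -- Iterated differences then replace integration by parts.
  set h : ℝ := Real.pi / k j with hh
  set v : ι → ℝ := h • Pi.single j 1 with hv
  have hexp : Complex.exp (Complex.I * ∑ i, (k i : ℂ) * v i) = -1 := by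
    have : ∑ i, (k i : ℂ) * v i = Real.pi := by
      rw [Finset.sum_eq_single j]
      · simp only [hv, Pi.smul_apply, Pi.single_eq_same, smul_eq_mul, mul_one, hh]
        push_cast
        have : (k j : ℂ) ≠ 0 := by exact_mod_cast hk
        field_simp
      · intro i _ hi
        simp [hv, hi]
      · simp
    rw [this, mul_comm, Complex.exp_pi_mul_I]
  have hb : ∀ θ, ‖(_root_.fwdDiff v)^[m] g θ‖ ≤ |h| ^ m * M := by
    intro θ
    have e := fwdDiff_iterate_line g (Pi.single j 1) θ h 0 m
    rw [zero_smul, add_zero] at e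
    rw [hv, e]
    exact norm_fwdDiff_iterate_le (hcd θ) (hM θ) h 0
  have h2 := norm_angleCoeff_le hb k
  rw [hg.angleCoeff_fwdDiff_iterate hc hexp, norm_mul, norm_pow, norm_neg, Complex.norm_ofNat] at h2
  -- The factor 2 extracted here cancels the `2 ^ m` gained by differencing.
  have h3 : |h| = 2 * (Real.pi / 2 * |(k j : ℝ)|⁻¹) := by
    rw [hh, abs_div, abs_of_pos Real.pi_pos, div_eq_mul_inv]
    ring
  rw [h3, mul_pow, mul_assoc] at h2
  exact le_of_mul_le_mul_left h2 (by positivity)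

end Torus

/-! ### Summability over the frequency lattice -/

section LatticeSum

variable {n : ℕ}

/-- The decay rate of the Fourier coefficients of a function with `n + 1` derivatives. -/
def decayWeight (k : Fin n → ℤ) : ℝ := if k = 0 then 1 else (Real.pi / 2 * ‖k‖⁻¹) ^ (n + 1)

theorem decayWeight_nonneg (k : Fin n → ℤ) : 0 ≤ decayWeight k := by
  unfold decayWeight
  split_ifs <;> positivity

/-- The exponent exceeds the rank `n` of the lattice `ℤⁿ`. This is where `n + 1` derivatives, hence
`⌊ℓ⌋ ≥ n + 1`, are needed. -/
theorem summable_norm_inv_pow : Summable fun k : Fin n → ℤ => ‖k‖⁻¹ ^ (n + 1) := by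
  let b := Pi.basisFun ℝ (Fin n)
  let L : Submodule ℤ (Fin n → ℝ) := Submodule.span ℤ (Set.range b)
  let bL : Module.Basis (Fin n) ℤ L := b.restrictScalars ℤ
  have hfin : Module.finrank ℤ L < n + 1 := by
    rw [Module.finrank_eq_card_basis bL, Fintype.card_fin]
    omega
  have hs := ZLattice.summable_norm_pow_inv L (n + 1) hfin
  have := (bL.equivFun.symm.toEquiv.summable_iff).2 hs
  refine this.congr fun k => ?_
  simp only [Function.comp_apply]
  congr 2
  have hval : ((bL.equivFun.symm k : L) : Fin n → ℝ) = fun j => (k j : ℝ) := by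
    have hb : ∀ x, ((bL x : L) : Fin n → ℝ) = Pi.single x 1 := fun x =>
      (b.restrictScalars_apply ℤ x).trans (Pi.basisFun_apply ℝ (Fin n) x)
    rw [Module.Basis.equivFun_symm_apply]
    ext j
    simp [hb, Finset.sum_apply, Pi.single_apply]
  change ‖((bL.equivFun.symm k : L) : Fin n → ℝ)‖ = ‖k‖
  rw [hval]
  simp only [Pi.norm_def]
  congr 1

theorem summable_decayWeight : Summable (decayWeight : (Fin n → ℤ) → ℝ) := by
  have h1 : Summable fun k : Fin n → ℤ => (Real.pi / 2) ^ (n + 1) * ‖k‖⁻¹ ^ (n + 1) :=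
    summable_norm_inv_pow.mul_left _
  have h2 : Summable fun k : Fin n → ℤ => if k = 0 then (1 : ℝ) else 0 :=
    summable_of_ne_finset_zero (s := {0}) fun k hk => if_neg (by simpa using hk)
  refine Summable.of_nonneg_of_le decayWeight_nonneg (fun k => ?_) (h1.add h2)
  unfold decayWeight
  split_ifs with hk
  · exact le_add_of_nonneg_left (by positivity)
  · rw [mul_pow, add_zero]

/-- Decay of the Fourier coefficients of a periodic function with `n + 1` bounded derivatives. -/
theorem TwoPiPeriodic.norm_angleCoeff_le_decayWeight {g : (Fin n → ℝ) → ℂ}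
    (hg : TwoPiPeriodic g) (hc : Continuous g) {M : ℝ} (hM0 : ∀ θ, ‖g θ‖ ≤ M)
    (hcd : ∀ (j : Fin n) (θ : Fin n → ℝ),
      ContDiff ℝ (n + 1 : ℕ) fun t : ℝ => g (θ + t • Pi.single j 1))
    (hM : ∀ (j : Fin n) (θ : Fin n → ℝ) (t : ℝ),
      ‖iteratedDeriv (n + 1) (fun t : ℝ => g (θ + t • Pi.single j 1)) t‖ ≤ M)
    (k : Fin n → ℤ) : ‖angleCoeff g k‖ ≤ decayWeight k * M := by
  unfold decayWeight
  split_ifs with hk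
  · rw [one_mul]
    exact norm_angleCoeff_le hM0 k
  · obtain ⟨i, hi⟩ : ∃ i, k i ≠ 0 := by
      by_contra! h
      exact hk (funext h)
    have : Nonempty (Fin n) := ⟨i⟩
    -- Differentiating along the coordinate where `|k j|` is largest gives decay in the sup norm of
    -- `k`.
    obtain ⟨j, hj⟩ : ∃ j, ‖k‖ = ‖k j‖ := by
      obtain ⟨j, -, hj⟩ := Finset.exists_mem_eq_sup Finset.univ Finset.univ_nonempty
        fun j => ‖k j‖₊
      exact ⟨j, by rw [Pi.norm_def, hj]; rfl⟩
    have hkj : k j ≠ 0 := by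
      rw [← norm_ne_zero_iff, ← hj, norm_ne_zero_iff]
      exact hk
    have := hg.norm_angleCoeff_le_of_deriv hc (hcd j) (hM j) hkj
    rwa [hj, Int.norm_eq_abs]

end LatticeSum
end Smoothing
end

open scoped ENNReal
noncomputable section
namespace Smoothing

open Filter Topology Set MeasureTheory

/-! ### Mollification in the angles as a Fourier multiplier -/

section Characters

variable {n : ℕ}

/-- The Fourier multiplier of the mollifier at scale `s`. -/
def freqCutoff (s : ℝ) (k : Fin n → ℤ) : ℂ := ∏ j, cutoffC (s * k j / (2 * Real.pi))

/-- A finite set of frequencies containing the support of the multiplier. -/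
def freqBox (n : ℕ) (s : ℝ) : Finset (Fin n → ℤ) :=
  Fintype.piFinset fun _ => Finset.Icc (-⌈2 * Real.pi / s⌉) ⌈2 * Real.pi / s⌉

theorem abs_mul_lt_of_freqCutoff_ne_zero {s : ℝ} (hs : 0 < s) {k : Fin n → ℤ}
    (h : freqCutoff s k ≠ 0) (j : Fin n) : s * |(k j : ℝ)| < 2 * Real.pi := by
  have h1 := Finset.prod_ne_zero_iff.1 h j (Finset.mem_univ j)
  by_contra hlt
  refine h1 (cutoffC_eq_zero ?_)
  rw [abs_div, abs_mul, abs_of_pos hs, abs_of_pos (by positivity : 0 < 2 * Real.pi), le_div_iff₀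
    (by positivity), one_mul]
  exact not_lt.1 hlt

theorem mem_freqBox_of_freqCutoff_ne_zero {s : ℝ} (hs : 0 < s) {k : Fin n → ℤ}
    (h : freqCutoff s k ≠ 0) : k ∈ freqBox n s := by
  rw [freqBox, Fintype.mem_piFinset]
  intro j
  have h1 : |(k j : ℝ)| ≤ 2 * Real.pi / s := by
    rw [le_div_iff₀ hs, mul_comm]
    exact (abs_mul_lt_of_freqCutoff_ne_zero hs h j).le
  rw [Finset.mem_Icc, ← abs_le]
  have h2 : ((|k j| : ℤ) : ℝ) ≤ ⌈2 * Real.pi / s⌉ := by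
    push_cast
    exact h1.trans (Int.le_ceil _)
  exact_mod_cast h2

theorem norm_freqCutoff_le_one (s : ℝ) (k : Fin n → ℤ) : ‖freqCutoff s k‖ ≤ 1 := by
  rw [freqCutoff, norm_prod]
  exact Finset.prod_le_one (fun _ _ => norm_nonneg _) fun _ _ => norm_cutoffC_le_one _

/-- On the support of the multiplier each `s * |k j|` is below `2π`, so the exponential weight is
bounded independently of `s` and `k`. -/
theorem norm_freqCutoff_mul_exp_le {s : ℝ} (hs : 0 < s) (k : Fin n → ℤ) :
    ‖freqCutoff s k‖ * Real.exp ((∑ j, |(k j : ℝ)|) * s) ≤ Real.exp (2 * Real.pi * n) := by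
  by_cases h : freqCutoff s k = 0
  · rw [h, norm_zero, zero_mul]
    positivity
  · refine (mul_le_of_le_one_left (Real.exp_pos _).le (norm_freqCutoff_le_one s k)).trans
      (Real.exp_le_exp.2 ?_)
    rw [Finset.sum_mul]
    refine (Finset.sum_le_card_nsmul _ _ (2 * Real.pi) fun j _ => ?_).trans (le_of_eq ?_)
    · rw [mul_comm]
      exact (abs_mul_lt_of_freqCutoff_ne_zero hs h j).le
    · simp [mul_comm]

theorem character_ofReal_add_two_pi (k m : Fin n → ℤ) (θ : Fin n → ℂ) :
    character k (fun j => θ j + ((2 * Real.pi * (m j : ℝ) : ℝ) : ℂ)) = character k θ := by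
  unfold character
  have : Complex.I * ∑ j, (k j : ℂ) * (θ j + ((2 * Real.pi * (m j : ℝ) : ℝ) : ℂ))
      = Complex.I * ∑ j, (k j : ℂ) * θ j
        + ((∑ j, k j * m j : ℤ) : ℂ) * (2 * Real.pi * Complex.I) := by
    push_cast
    simp only [mul_add, Finset.sum_add_distrib, Finset.mul_sum, Finset.sum_mul]
    congr 1
    refine Finset.sum_congr rfl fun j _ => ?_
    ring
  rw [this, Complex.exp_add, Complex.exp_int_mul_two_pi_mul_I, mul_one]

theorem norm_character_ofReal (k : Fin n → ℤ) (θ : Fin n → ℝ) :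
    ‖character k (fun j => (θ j : ℂ))‖ = 1 := by
  have : Complex.I * ∑ j, (k j : ℂ) * (θ j : ℂ) = ((∑ j, (k j : ℝ) * θ j : ℝ) : ℂ) * Complex.I := by
    push_cast
    ring
  rw [character, this, Complex.norm_exp_ofReal_mul_I]

theorem TwoPiPeriodic.hasSum_angleCoeff {g : (Fin n → ℝ) → ℂ} (hg : TwoPiPeriodic g)
    (hc : Continuous g) (hs : Summable (angleCoeff g)) (θ : Fin n → ℝ) :
    HasSum (fun k => angleCoeff g k * character k (fun j => (θ j : ℂ))) (g θ) := by
  have := UnitAddTorus.hasSum_mFourier_series_apply_of_summable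
    (f := ⟨torusLift g, hg.continuous_torusLift hc⟩) hs (torusMk θ)
  simp only [ContinuousMap.coe_mk, hg.torusLift_torusMk, mFourier_torusMk, smul_eq_mul] at this
  exact this

theorem integral_pi_prod (g : Fin n → ℝ → ℂ) :
    ∫ u : Fin n → ℝ, ∏ i, g i (u i) = ∏ i, ∫ t : ℝ, g i t :=
  integral_fintype_prod_volume_eq_prod _

theorem integrable_kern : Integrable fun t : ℝ => kern t := by
  simpa using integrable_pow_mul_kern 0

theorem integrable_prod_kern : Integrable fun v : Fin n → ℝ => ∏ j, kern (v j) :=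
  Integrable.fintype_prod (f := fun _ t => kern (t : ℝ)) fun _ => integrable_kern

/-- Mollifying a periodic function of the angles with absolutely summable Fourier coefficients
gives a trigonometric polynomial. -/
theorem TwoPiPeriodic.integral_mul_prod_kern {g : (Fin n → ℝ) → ℂ} (hg : TwoPiPeriodic g)
    (hc : Continuous g) (hsum : Summable (angleCoeff g)) {s : ℝ} (hs : 0 < s) (θ : Fin n → ℝ) :
    ∫ v : Fin n → ℝ, g (fun j => θ j - s * v j) * ∏ j, kern (v j)
      = ∑ k ∈ freqBox n s, freqCutoff s k * angleCoeff g k * character k (fun j => (θ j : ℂ)) := by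
  set F : (Fin n → ℤ) → (Fin n → ℝ) → ℂ := fun k v =>
    angleCoeff g k * character k (fun j => ((θ j - s * v j : ℝ) : ℂ)) * ∏ j, kern (v j) with hF
  have hcont : ∀ k : Fin n → ℤ, Continuous fun v : Fin n → ℝ =>
      angleCoeff g k * character k (fun j => ((θ j - s * v j : ℝ) : ℂ)) := by
    intro k
    unfold character
    fun_prop
  have hnorm : ∀ k v, ‖F k v‖ = ‖angleCoeff g k‖ * ‖∏ j, kern (v j)‖ := by
    intro k v
    simp only [hF]
    rw [norm_mul, norm_mul, norm_character_ofReal, mul_one]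
  have hint : ∀ k, Integrable (F k) := fun k => by
    refine (integrable_prod_kern.norm.const_mul ‖angleCoeff g k‖).mono' ?_
      (ae_of_all _ fun v => (hnorm k v).le)
    exact (hcont k).aestronglyMeasurable.mul integrable_prod_kern.aestronglyMeasurable
  have hS : Summable fun k => ∫ v, ‖F k v‖ := by
    simp only [hnorm, integral_const_mul]
    exact hsum.norm.mul_right _
  have h := hasSum_integral_of_summable_integral_norm hint hS
  have h1 : ∀ v : Fin n → ℝ, ∑' k, F k v = g (fun j => θ j - s * v j) * ∏ j, kern (v j) := by
    intro v
    simp only [hF]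
    rw [tsum_mul_right, (hg.hasSum_angleCoeff hc hsum fun j => θ j - s * v j).tsum_eq]
  -- Each character is an eigenfunction of the mollification: coordinate by coordinate the integral
  -- is the Fourier transform of `kern` at `s * k j / (2π)`, namely the cutoff there.
  have h2 : ∀ k, ∫ v, F k v
      = freqCutoff s k * angleCoeff g k * character k (fun j => (θ j : ℂ)) := by
    intro k
    have e : ∀ v, F k v = angleCoeff g k * character k (fun j => (θ j : ℂ)) *
        ∏ j, (kern (v j) *
          Complex.exp (-(2 * Real.pi * Complex.I * ((s * k j / (2 * Real.pi) : ℝ) : ℂ) * v j))) := by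
      intro v
      have hpi : (Real.pi : ℂ) ≠ 0 := by exact_mod_cast Real.pi_ne_zero
      simp only [hF, character]
      rw [Finset.prod_mul_distrib, ← Complex.exp_sum]
      have : Complex.exp (Complex.I * ∑ j, (k j : ℂ) * ((θ j - s * v j : ℝ) : ℂ))
          = Complex.exp (Complex.I * ∑ j, (k j : ℂ) * (θ j : ℂ)) * Complex.exp (∑ j,
            -(2 * Real.pi * Complex.I * ((s * k j / (2 * Real.pi) : ℝ) : ℂ) * v j)) := by
        rw [← Complex.exp_add, Finset.mul_sum, Finset.mul_sum, ← Finset.sum_add_distrib]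
        congr 1
        refine Finset.sum_congr rfl fun j _ => ?_
        push_cast
        field_simp
        ring
      rw [this]
      ring
    simp only [e]
    rw [integral_const_mul, integral_pi_prod (fun j t => kern (t : ℝ) *
      Complex.exp (-(2 * Real.pi * Complex.I * ((s * k j / (2 * Real.pi) : ℝ) : ℂ) * (t : ℝ))))]
    simp only [integral_kern_mul_exp]
    rw [freqCutoff]
    ring
  simp only [h1, h2] at h
  refine h.unique (hasSum_sum_of_ne_finset_zero fun k hk => ?_)
  have : freqCutoff s k = 0 := by
    by_contra h0
    exact hk (mem_freqBox_of_freqCutoff_ne_zero hs h0)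
  simp [this]

theorem setIntegral_exp_int (m : ℤ) :
    ∫ x in Set.Icc (0 : ℝ) (2 * Real.pi), Complex.exp (Complex.I * m * x)
      = if m = 0 then 2 * (Real.pi : ℂ) else 0 := by
  rw [integral_Icc_eq_integral_Ioc, ← intervalIntegral.integral_of_le (by positivity)]
  split_ifs with h
  · simp [h]
  · have hm : (Complex.I * m : ℂ) ≠ 0 :=
      mul_ne_zero Complex.I_ne_zero (by exact_mod_cast h)
    rw [integral_exp_mul_complex hm]
    have : Complex.exp (Complex.I * m * ((2 * Real.pi : ℝ) : ℂ)) = 1 := by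
      rw [← Complex.exp_int_mul_two_pi_mul_I m]
      congr 1
      push_cast
      ring
    rw [this]
    simp

theorem setIntegral_character_mul_character (k l : Fin n → ℤ) :
    ∫ θ in Set.Icc (0 : Fin n → ℝ) (fun _ => 2 * Real.pi),
      character l (fun j => (θ j : ℂ)) * character (-k) (fun j => (θ j : ℂ))
      = if l = k then (((2 * Real.pi) ^ n : ℝ) : ℂ) else 0 := by
  have h1 : ∀ θ : Fin n → ℝ, character l (fun j => (θ j : ℂ)) *
      character (-k) (fun j => (θ j : ℂ))
      = ∏ j, Complex.exp (Complex.I * ((l j - k j : ℤ) : ℂ) * (θ j : ℂ)) := by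
    intro θ
    rw [character, character, ← Complex.exp_add, ← Complex.exp_sum, ← mul_add,
      ← Finset.sum_add_distrib, Finset.mul_sum]
    congr 1
    refine Finset.sum_congr rfl fun j _ => ?_
    simp only [Pi.neg_apply]
    push_cast
    ring
  simp only [h1]
  rw [← Set.pi_univ_Icc, volume_pi, Measure.restrict_pi_pi,
    integral_fintype_prod_eq_prod (𝕜 := ℂ)
      (fun j (x : ℝ) => Complex.exp (Complex.I * ((l j - k j : ℤ) : ℂ) * (x : ℂ)))]
  simp only [Pi.zero_apply, setIntegral_exp_int]
  split_ifs with h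
  · subst h
    simp
  · obtain ⟨j, hj⟩ := Function.ne_iff.1 h
    refine Finset.prod_eq_zero (Finset.mem_univ j) (if_neg ?_)
    exact sub_ne_zero.2 hj

/-- Orthogonality of the characters on the cube `[0, 2π]ⁿ`. The coefficients in the weighted norm
are thus read off from the finite sum defining `smooth`. -/
theorem angleFourierCoeff_sum (S : Finset (Fin n → ℤ))
    (c : (Fin n → ℤ) → EuclideanSpace ℂ (Fin n) → ℂ) (k : Fin n → ℤ)
    (I : EuclideanSpace ℂ (Fin n)) :
    angleFourierCoeff (fun z => ∑ l ∈ S, c l (actions z) * character l (angles z)) k I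
      = if k ∈ S then c k I else 0 := by
  have ha : ∀ θ : Fin n → ℂ, actions (mkPhase I θ) = I := fun θ => rfl
  have hb : ∀ θ : Fin n → ℂ, angles (mkPhase I θ) = θ := fun θ => rfl
  rw [angleFourierCoeff]
  simp only [ha, hb, Finset.sum_mul, mul_assoc]
  have hint : ∀ l : Fin n → ℤ, IntegrableOn (fun θ : Fin n → ℝ => c l I *
      (character l (fun j => (θ j : ℂ)) * character (-k) (fun j => (θ j : ℂ))))
      (Set.Icc (0 : Fin n → ℝ) (fun _ => 2 * Real.pi)) := by
    intro l
    refine ContinuousOn.integrableOn_compact isCompact_Icc (Continuous.continuousOn ?_)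
    unfold character
    fun_prop
  rw [integral_finsetSum _ fun l _ => hint l]
  simp only [integral_const_mul, setIntegral_character_mul_character, mul_ite, mul_zero,
    Finset.sum_ite_eq']
  split_ifs with h
  · have h0 : ((2 * Real.pi) ^ n : ℝ) ≠ 0 := by positivity
    have : (((2 * Real.pi) ^ n : ℝ) : ℂ) ≠ 0 := Complex.ofReal_ne_zero.2 h0
    rw [Complex.ofReal_inv]
    field_simp
  · rfl

end Characters

/-! ### Mollification in complex actions -/

section Actions

variable {n : ℕ}

/-- The mollification at scale `s` of a function of the actions, continued to complex actions. -/
def actionMollify (s : ℝ) (h : (Fin n → ℝ) → ℂ) (I : EuclideanSpace ℂ (Fin n)) : ℂ :=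
  ∫ u : Fin n → ℝ, h (s • u) * ∏ j, kern (I j / s - u j)

/-- An absolute bound for the `L¹` norm of the mollifier on lines in the strip of width one. -/
theorem exists_norm_actionMollify_le (n : ℕ) :
    ∃ C : ℝ, 0 < C ∧ ∀ (s : ℝ) (h : (Fin n → ℝ) → ℂ) (A : ℝ) (I : EuclideanSpace ℂ (Fin n)),
      0 < s → (∀ x, ‖h x‖ ≤ A) → (∀ j, |(I j).im| ≤ s) → ‖actionMollify s h I‖ ≤ C * A := by
  obtain ⟨C, hC, hk⟩ := exists_norm_kern_le
  refine ⟨(C * Real.pi) ^ n, by positivity, fun s h A I hs hA hI => ?_⟩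
  have hA0 : 0 ≤ A := (norm_nonneg _).trans (hA 0)
  have hi : ∀ x : ℝ, Integrable fun t : ℝ => C * (1 + (x - t) ^ 2)⁻¹ := fun x =>
    (integrable_inv_one_add_sq.comp_sub_left x).const_mul C
  have hv : ∀ x : ℝ, ∫ t : ℝ, C * (1 + (x - t) ^ 2)⁻¹ = C * Real.pi := fun x => by
    rw [integral_const_mul, integral_sub_left_eq_self (fun t : ℝ => (1 + t ^ 2)⁻¹) volume x,
      integral_univ_inv_one_add_sq]
  have hb := norm_integral_le_of_norm_le
    (f := fun u : Fin n → ℝ => h (s • u) * ∏ j, kern (I j / s - u j))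
    (g := fun u : Fin n → ℝ => A * ∏ j, (C * (1 + ((I j / s).re - u j) ^ 2)⁻¹))
    ((Integrable.fintype_prod (f := fun j t => C * (1 + ((I j / s).re - t) ^ 2)⁻¹)
      fun j => hi _).const_mul A) (ae_of_all _ fun u => ?_)
  · rw [integral_const_mul, integral_fintype_prod_eq_prod
      (fun j (t : ℝ) => C * (1 + ((I j / s).re - t) ^ 2)⁻¹)] at hb
    simp only [hv, Finset.prod_const, Finset.card_univ, Fintype.card_fin] at hb
    rw [mul_comm]
    exact hb
  · rw [norm_mul, norm_prod]
    refine mul_le_mul (hA _) (Finset.prod_le_prod (fun _ _ => norm_nonneg _) fun j _ => ?_)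
      (Finset.prod_nonneg fun _ _ => norm_nonneg _) hA0
    -- The width `s` of the action domain matches the mollification scale, so the argument of `kern`
    -- stays in the strip of width one.
    have him : |(I j / s - u j).im| ≤ 1 := by
      rw [Complex.sub_im, Complex.div_ofReal_im, Complex.ofReal_im, sub_zero, abs_div,
        abs_of_pos hs, div_le_one hs]
      exact hI j
    simpa using hk _ him

/-- On a compact `K`, the map is a composition of a continuous linear map `E → C(K, ℂ)`, the
exponential of that Banach algebra, and a continuous linear functional. Analyticity follows without
differentiating under the integral. -/
theorem analyticOnNhd_integral_exp {E : Type*} [NormedAddCommGroup E] [NormedSpace ℂ E]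
    [FiniteDimensional ℂ E] {X : Type*} [TopologicalSpace X] [MeasurableSpace X] [BorelSpace X]
    {ν : Measure X} {K : Set X} (hK : IsCompact K) (hKm : MeasurableSet K) {w : X → ℂ}
    (hw : IntegrableOn w K ν) {L : X → E →L[ℂ] ℂ} (hL : ∀ I, Continuous fun x => L x I) :
    AnalyticOnNhd ℂ (fun I => ∫ x in K, w x * Complex.exp (L x I) ∂ν) Set.univ := by
  have : CompactSpace K := isCompact_iff_compactSpace.1 hK
  let Λ : E →L[ℂ] C(K, ℂ) := LinearMap.toContinuousLinearMap
    { toFun := fun I => ⟨fun x => L x I, (hL I).comp continuous_subtype_val⟩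
      map_add' := fun I J => by ext x; simp
      map_smul' := fun c I => by ext x; simp }
  have hw' : Integrable (fun x : K => w x) (ν.comap Subtype.val) :=
    (integrableOn_iff_comap_subtypeVal hKm).1 hw
  have hmul : ∀ h : C(K, ℂ), Integrable (fun x : K => w x * h x) (ν.comap Subtype.val) :=
    fun h => hw'.mul_bdd (c := ‖h‖) h.continuous.aestronglyMeasurable
      (ae_of_all _ fun x => h.norm_coe_le_norm x)
  let Ψ : C(K, ℂ) →L[ℂ] ℂ := LinearMap.mkContinuous
    { toFun := fun h => ∫ x : K, w x * h x ∂(ν.comap Subtype.val)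
      map_add' := fun h h' => by
        simp only [ContinuousMap.add_apply, mul_add]
        exact integral_add (hmul h) (hmul h')
      map_smul' := fun c h => by
        simp only [ContinuousMap.smul_apply, smul_eq_mul, RingHom.id_apply]
        rw [← integral_const_mul]
        congr 1
        ext x
        ring }
    (∫ x : K, ‖w x‖ ∂(ν.comap Subtype.val)) (fun h => by
      change ‖∫ x : K, w x * h x ∂(ν.comap Subtype.val)‖ ≤ _
      rw [← integral_mul_const]
      refine norm_integral_le_of_norm_le (hw'.norm.mul_const _) (ae_of_all _ fun x => ?_)
      rw [norm_mul]
      exact mul_le_mul_of_nonneg_left (h.norm_coe_le_norm x) (norm_nonneg _))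
  have heq : (fun I => ∫ x in K, w x * Complex.exp (L x I) ∂ν)
      = fun I => Ψ (NormedSpace.exp (Λ I)) := by
    ext I
    change _ = ∫ x : K, w x * (NormedSpace.exp (Λ I)) x ∂(ν.comap Subtype.val)
    rw [← integral_subtype_comap hKm]
    refine integral_congr_ae (ae_of_all _ fun x => ?_)
    simp only
    congr 1
    -- Evaluation at `x` is a continuous algebra homomorphism, so the exponential in `C(K, ℂ)` is
    -- pointwise.
    have := NormedSpace.map_exp (ContinuousMap.evalAlgHom ℂ ℂ x)
      (continuous_eval_const x) (Λ I)
    rw [← Complex.exp_eq_exp_ℂ] at this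
    exact this.symm
  rw [heq]
  intro I _
  have h1 : AnalyticAt ℂ (NormedSpace.exp : C(K, ℂ) → C(K, ℂ)) (Λ I) :=
    NormedSpace.exp_analytic _
  exact (Ψ.analyticAt _).comp (h1.comp (Λ.analyticAt I))

/-- The mollification of a bounded compactly supported function of the actions is entire. -/
theorem analyticOnNhd_actionMollify {s : ℝ} (hs : 0 < s) {h : (Fin n → ℝ) → ℂ} {A ρ : ℝ}
    (hm : Measurable h) (hA : ∀ x, ‖h x‖ ≤ A) (hsupp : ∀ x, h x ≠ 0 → ∀ j, |x j| ≤ ρ) :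
    AnalyticOnNhd ℂ (actionMollify s h) Set.univ := by
  -- Inserting the integral that defines `kern` gives a double integral over `(u, ξ)`. The support
  -- of `h` confines `s • u` and that of the cutoff confines `ξ`, so it lives on the compact set `U
  -- ×ˢ W`, and `I` appears only linearly inside an exponential.
  set U : Set (Fin n → ℝ) := Set.Icc (fun _ => -(ρ / s)) (fun _ => ρ / s) with hU
  set W : Set (Fin n → ℝ) := Set.Icc (fun _ => -1) (fun _ => 1) with hW
  let w : (Fin n → ℝ) × (Fin n → ℝ) → ℂ := fun p => h (s • p.1) *
    (∏ j, cutoffC (p.2 j)) * Complex.exp (-∑ j, 2 * Real.pi * Complex.I * p.1 j * p.2 j)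
  let L : (Fin n → ℝ) × (Fin n → ℝ) → EuclideanSpace ℂ (Fin n) →L[ℂ] ℂ := fun p =>
    ∑ j, (2 * Real.pi * Complex.I * p.2 j / s : ℂ) • EuclideanSpace.proj j
  have hLapp : ∀ p I, L p I = ∑ j, (2 * Real.pi * Complex.I * p.2 j / s : ℂ) * I j := by
    intro p I
    simp [L, sum_apply]
  have hcut : Continuous cutoffC := (contDiff_cutoffC (r := 0)).continuous
  have hwm : Measurable w := by
    have h1 : Measurable fun p : (Fin n → ℝ) × (Fin n → ℝ) => h (s • p.1) :=
      hm.comp (measurable_fst.const_smul s)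
    have h2 : Continuous fun p : (Fin n → ℝ) × (Fin n → ℝ) => ∏ j, cutoffC (p.2 j) :=
      continuous_finsetProd _ fun j _ =>
        hcut.comp ((continuous_apply j).comp continuous_snd)
    have h3 : Continuous fun p : (Fin n → ℝ) × (Fin n → ℝ) =>
        Complex.exp (-∑ j, 2 * Real.pi * Complex.I * p.1 j * p.2 j) := by fun_prop
    exact (h1.mul h2.measurable).mul h3.measurable
  have hA0 : 0 ≤ A := (norm_nonneg _).trans (hA 0)
  have hwb : ∀ p, ‖w p‖ ≤ A := by
    intro p
    simp only [w]
    have e : -∑ j, 2 * Real.pi * Complex.I * p.1 j * p.2 j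
        = ((-∑ j, 2 * Real.pi * p.1 j * p.2 j : ℝ) : ℂ) * Complex.I := by
      push_cast
      rw [neg_mul, Finset.sum_mul]
      congr 1
      refine Finset.sum_congr rfl fun j _ => ?_
      ring
    rw [e, norm_mul, norm_mul, Complex.norm_exp_ofReal_mul_I, mul_one, norm_prod]
    calc _ ≤ A * 1 := mul_le_mul (hA _) (Finset.prod_le_one (fun _ _ => norm_nonneg _)
          fun _ _ => norm_cutoffC_le_one _) (Finset.prod_nonneg fun _ _ => norm_nonneg _) hA0
      _ = A := mul_one A
  have hKc : IsCompact (U ×ˢ W) := isCompact_Icc.prod isCompact_Icc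
  have hbd : ∀ g : (Fin n → ℝ) × (Fin n → ℝ) → ℂ, Measurable g → (∃ B, ∀ p ∈ U ×ˢ W, ‖g p‖ ≤ B) →
      IntegrableOn g (U ×ˢ W) (volume.prod volume) := by
    rintro g hg ⟨B, hB⟩
    exact IntegrableOn.of_bound hKc.measure_lt_top hg.aestronglyMeasurable B
      ((ae_restrict_iff' hKc.measurableSet).2 (ae_of_all _ hB))
  have hLc : ∀ I, Continuous fun p => L p I := by
    intro I
    simp only [hLapp]
    fun_prop
  have key := analyticOnNhd_integral_exp hKc hKc.measurableSet
    (hbd w hwm ⟨A, fun p _ => hwb p⟩) hLc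
  refine key.congr isOpen_univ fun I _ => ?_
  have hint : IntegrableOn (fun p => w p * Complex.exp (L p I)) (U ×ˢ W)
      (volume.prod volume) := by
    have hc : Continuous fun p => Complex.exp (L p I) := Complex.continuous_exp.comp (hLc I)
    obtain ⟨B, hB⟩ := hKc.exists_bound_of_continuousOn hc.continuousOn
    refine hbd _ (hwm.mul hc.measurable) ⟨A * B, fun p hp => ?_⟩
    rw [norm_mul]
    exact mul_le_mul (hwb p) (hB p hp) (norm_nonneg _) hA0
  rw [setIntegral_prod _ hint, actionMollify]
  have hin : ∀ u : Fin n → ℝ, ∫ ξ in W, w (u, ξ) * Complex.exp (L (u, ξ) I)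
      = h (s • u) * ∏ j, kern (I j / s - u j) := by
    intro u
    have e : ∀ ξ : Fin n → ℝ, w (u, ξ) * Complex.exp (L (u, ξ) I) = h (s • u) *
        ∏ j, (cutoffC (ξ j) *
          Complex.exp (2 * Real.pi * Complex.I * (I j / s - u j) * (ξ j : ℝ))) := by
      intro ξ
      rw [hLapp]
      simp only [w]
      rw [Finset.prod_mul_distrib, ← Complex.exp_sum, mul_assoc, ← Complex.exp_add, mul_assoc]
      congr 3
      rw [neg_add_eq_sub, ← Finset.sum_sub_distrib]
      refine Finset.sum_congr rfl fun j _ => ?_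
      ring
    rw [setIntegral_eq_integral_of_forall_compl_eq_zero]
    · simp only [e]
      rw [integral_const_mul, integral_pi_prod (fun j t => cutoffC t *
        Complex.exp (2 * Real.pi * Complex.I * (I j / s - u j) * (t : ℝ)))]
      rfl
    · intro ξ hξ
      rw [e]
      obtain ⟨j, hj⟩ : ∃ j, cutoffC (ξ j) = 0 := by
        by_contra! hne
        refine hξ ⟨fun j => ?_, fun j => ?_⟩
        · exact (abs_le.1 (not_lt.1 fun hlt => hne j (cutoffC_eq_zero hlt.le))).1
        · exact (abs_le.1 (not_lt.1 fun hlt => hne j (cutoffC_eq_zero hlt.le))).2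
      rw [Finset.prod_eq_zero (Finset.mem_univ j) (by rw [hj, zero_mul]), mul_zero]
  simp only [hin]
  refine setIntegral_eq_integral_of_forall_compl_eq_zero fun u hu => ?_
  have : h (s • u) = 0 := by
    by_contra hne
    have hb := hsupp _ hne
    have hb' : ∀ j, |u j| ≤ ρ / s := by
      intro j
      have := hb j
      rw [Pi.smul_apply, smul_eq_mul, abs_mul, abs_of_pos hs] at this
      rwa [le_div_iff₀ hs, mul_comm]
    exact hu ⟨fun j => (abs_le.1 (hb' j)).1, fun j => (abs_le.1 (hb' j)).2⟩
  rw [this, zero_mul]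

end Actions
end Smoothing
end

open scoped ENNReal
noncomputable section
namespace Smoothing

open Filter Topology Set MeasureTheory

/-! ### Splitting phase space into actions and angles -/

section PhaseSpace

variable {n : ℕ}

theorem isOpen_actionBox (n : ℕ) (ρ : ℝ) : IsOpen (actionBox n ρ) := by
  have : actionBox n ρ = ⋂ j : Fin n, {x | |x (Sum.inl j)| < ρ} := by
    ext x
    simp [actionBox, actions]
  rw [this]
  exact isOpen_iInter_of_finite fun j => isOpen_lt (by fun_prop) continuous_const

theorem ball_subset_actionBox {R δ : ℝ} (hδ : δ ≤ R) {x : Phase ℝ n} (hx : x ∈ actionBox n R) :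
    Metric.ball x δ ⊆ actionBox n (2 * R) := by
  intro y hy j
  have h1 : |y (Sum.inl j) - x (Sum.inl j)| < δ := by
    rw [mem_ball_iff_norm] at hy
    exact (PiLp.norm_apply_le (y - x) (Sum.inl j)).trans_lt hy
  have h2 : |x (Sum.inl j)| < R := hx j
  have h3 := abs_sub_abs_le_abs_sub (y (Sum.inl j)) (x (Sum.inl j))
  change |y (Sum.inl j)| < 2 * R
  linarith

/-- The point with given real actions and angles. -/
def realPhase (a θ : Fin n → ℝ) : Phase ℝ n := mkPhase (WithLp.toLp 2 a) θ

theorem realPhase_mem_actionBox {ρ : ℝ} {a θ : Fin n → ℝ} :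
    realPhase a θ ∈ actionBox n ρ ↔ ∀ j, |a j| < ρ := Iff.rfl

theorem continuous_realPhase :
    Continuous fun p : (Fin n → ℝ) × (Fin n → ℝ) => realPhase p.1 p.2 := by
  refine (PiLp.continuous_toLp 2 _).comp (continuous_pi fun i => ?_)
  cases i with
  | inl j => exact (continuous_apply j).comp continuous_fst
  | inr j => exact (continuous_apply j).comp continuous_snd

theorem realPhase_add_smul_single (a θ : Fin n → ℝ) (t : ℝ) (j : Fin n) :
    realPhase a (θ + t • Pi.single j 1)
      = realPhase a θ + t • EuclideanSpace.single (Sum.inr j) (1 : ℝ) := by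
  ext i
  cases i with
  | inl i => simp [realPhase, mkPhase]
  | inr i => simp [realPhase, mkPhase, Pi.single_apply]

theorem realPhase_sub_smul (x : Phase ℝ n) (s : ℝ) (a b : Fin n → ℝ) :
    x - s • realPhase a b
      = realPhase (fun j => x (Sum.inl j) - s * a j) (fun j => x (Sum.inr j) - s * b j) := by
  ext i
  cases i with
  | inl i => simp [realPhase, mkPhase]
  | inr i => simp [realPhase, mkPhase]

theorem prodKern_realPhase (a b : Fin n → ℝ) :
    prodKern (Fin n ⊕ Fin n) (realPhase a b) = (∏ j, kern (a j)) * ∏ j, kern (b j) := by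
  rw [prodKern_apply, Fintype.prod_sum_type]
  rfl

theorem measurePreserving_realPhase :
    MeasurePreserving (fun p : (Fin n → ℝ) × (Fin n → ℝ) => realPhase p.1 p.2) := by
  have h1 := (PiLp.volume_preserving_toLp (Fin n ⊕ Fin n)).comp
    (volume_measurePreserving_sumPiEquivProdPi_symm fun _ : Fin n ⊕ Fin n => ℝ)
  convert! h1 using 1

theorem measurableEmbedding_realPhase :
    MeasurableEmbedding (fun p : (Fin n → ℝ) × (Fin n → ℝ) => realPhase p.1 p.2) := by
  have h1 := (MeasurableEquiv.toLp 2 (Fin n ⊕ Fin n → ℝ)).measurableEmbedding.comp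
    (MeasurableEquiv.sumPiEquivProdPi fun _ : Fin n ⊕ Fin n => ℝ).symm.measurableEmbedding
  convert! h1 using 1

theorem integral_phase {g : Phase ℝ n → ℂ} (hg : Integrable g) :
    ∫ x, g x = ∫ a : Fin n → ℝ, ∫ b : Fin n → ℝ, g (realPhase a b) := by
  rw [← measurePreserving_realPhase.integral_comp measurableEmbedding_realPhase]
  refine integral_prod _ ?_
  exact (measurePreserving_realPhase.integrable_comp_emb measurableEmbedding_realPhase).2 hg

end PhaseSpace

/-! ### The extension by zero and its angular Fourier coefficients -/

section Extension

variable {n : ℕ} {ρ ℓ : ℝ} {f : Phase ℝ n → ℝ}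

/-- The extension of `f` by zero outside the box. -/
def boxExtend (ρ : ℝ) (f : Phase ℝ n → ℝ) : Phase ℝ n → ℝ := (actionBox n ρ).indicator f

theorem measurable_boxExtend (hf : ContinuousOn f (actionBox n ρ)) :
    Measurable (boxExtend ρ f) := by
  classical
  rw [boxExtend, ← Set.piecewise_eq_indicator]
  exact hf.measurable_piecewise continuousOn_const (isOpen_actionBox n ρ).measurableSet

theorem abs_boxExtend_le (hf : IsHolder ℓ (actionBox n ρ) f) (x : Phase ℝ n) :
    |boxExtend ρ f x| ≤ (holderNorm ℓ (actionBox n ρ) f).toReal := by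
  by_cases hx : x ∈ actionBox n ρ
  · rw [boxExtend, Set.indicator_of_mem hx]
    have := norm_iteratedFDeriv_le_holderNorm (isOpen_actionBox n ρ) hf (Nat.zero_le _) hx
    simpa using this
  · rw [boxExtend, Set.indicator_of_notMem hx, abs_zero]
    exact ENNReal.toReal_nonneg

/-- The extension by zero, as a function of the angles at fixed actions. -/
def angleSlice (ρ : ℝ) (f : Phase ℝ n → ℝ) (a θ : Fin n → ℝ) : ℂ := boxExtend ρ f (realPhase a θ)

/-- The truncation depends on the actions alone: a slice is either all of `f` or identically zero,
so periodicity and smoothness in the angles survive it. -/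
theorem angleSlice_eq_zero {a : Fin n → ℝ} (ha : ¬ ∀ j, |a j| < ρ) : angleSlice ρ f a = 0 := by
  ext θ
  rw [angleSlice, boxExtend, Set.indicator_of_notMem (by rwa [realPhase_mem_actionBox])]
  rfl

theorem angleSlice_eq {a : Fin n → ℝ} (ha : ∀ j, |a j| < ρ) :
    angleSlice ρ f a = fun θ => (f (realPhase a θ) : ℂ) := by
  ext θ
  rw [angleSlice, boxExtend, Set.indicator_of_mem (realPhase_mem_actionBox.2 ha)]

theorem twoPiPeriodic_angleSlice (hf : AnglePeriodicOn f (actionBox n ρ)) (a : Fin n → ℝ) :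
    TwoPiPeriodic (angleSlice ρ f a) := by
  by_cases ha : ∀ j, |a j| < ρ
  · intro θ m
    rw [angleSlice_eq ha]
    exact congrArg _ (hf (realPhase a θ) (realPhase_mem_actionBox.2 ha) m)
  · intro θ m
    rw [angleSlice_eq_zero ha]
    rfl

theorem continuous_angleSlice (hf : ContinuousOn f (actionBox n ρ)) (a : Fin n → ℝ) :
    Continuous (angleSlice ρ f a) := by
  by_cases ha : ∀ j, |a j| < ρ
  · rw [angleSlice_eq ha]
    refine Complex.continuous_ofReal.comp (hf.comp_continuous
      (continuous_realPhase.comp (by fun_prop : Continuous fun θ : Fin n → ℝ => (a, θ)))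
      fun θ => realPhase_mem_actionBox.2 ha)
  · rw [angleSlice_eq_zero ha]
    exact continuous_const

theorem contDiff_angleSlice_line {m : ℕ} (hf : ContDiffOn ℝ m f (actionBox n ρ)) (a : Fin n → ℝ)
    (j : Fin n) (θ : Fin n → ℝ) :
    ContDiff ℝ m fun t : ℝ => angleSlice ρ f a (θ + t • Pi.single j 1) := by
  by_cases ha : ∀ j, |a j| < ρ
  · rw [angleSlice_eq ha]
    have h1 : ContDiff ℝ m fun t : ℝ => f (realPhase a (θ + t • Pi.single j 1)) := by
      simp only [realPhase_add_smul_single]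
      refine contDiff_iff_contDiffAt.2 fun t => ?_
      have hmem : realPhase a θ + t • EuclideanSpace.single (Sum.inr j) (1 : ℝ)
          ∈ actionBox n ρ := by
        rw [← realPhase_add_smul_single]
        exact realPhase_mem_actionBox.2 ha
      exact ((hf _ hmem).contDiffAt ((isOpen_actionBox n ρ).mem_nhds hmem)).comp t (by fun_prop)
    exact Complex.ofRealCLM.contDiff.comp h1
  · rw [angleSlice_eq_zero ha]
    exact contDiff_const

/-- Along a coordinate line the derivative is a pure partial derivative, so the Hölder norm bounds
it with constant one. -/
theorem norm_iteratedDeriv_angleSlice_line_le (hf : IsHolder ℓ (actionBox n ρ) f) {m : ℕ}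
    (hm : m ≤ ⌊ℓ⌋₊) (a : Fin n → ℝ) (j : Fin n) (θ : Fin n → ℝ) (t : ℝ) :
    ‖iteratedDeriv m (fun t : ℝ => angleSlice ρ f a (θ + t • Pi.single j 1)) t‖
      ≤ (holderNorm ℓ (actionBox n ρ) f).toReal := by
  by_cases ha : ∀ j, |a j| < ρ
  · have hfm : ContDiffOn ℝ m f (actionBox n ρ) := hf.1.of_le (by exact_mod_cast hm)
    have hmem : realPhase a θ + t • EuclideanSpace.single (Sum.inr j) (1 : ℝ)
        ∈ actionBox n ρ := by
      rw [← realPhase_add_smul_single]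
      exact realPhase_mem_actionBox.2 ha
    have h1 : ‖iteratedDeriv m (fun t : ℝ => angleSlice ρ f a (θ + t • Pi.single j 1)) t‖
        = ‖iteratedDeriv m (fun t : ℝ => f (realPhase a θ + t •
          EuclideanSpace.single (Sum.inr j) (1 : ℝ))) t‖ := by
      rw [← norm_iteratedFDeriv_eq_norm_iteratedDeriv,
        ← norm_iteratedFDeriv_eq_norm_iteratedDeriv]
      have hcd : ContDiffAt ℝ m (fun t : ℝ => f (realPhase a θ + t •
          EuclideanSpace.single (Sum.inr j) (1 : ℝ))) t :=
        ((hfm _ hmem).contDiffAt ((isOpen_actionBox n ρ).mem_nhds hmem)).comp t (by fun_prop)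
      rw [← Complex.ofRealLI.norm_iteratedFDeriv_comp_left hcd le_rfl, angleSlice_eq ha]
      simp only [realPhase_add_smul_single]
      rfl
    rw [h1, iteratedDeriv_comp_line (isOpen_actionBox n ρ) hfm _ _ hmem,
      iteratedFDeriv_single_eq_partialDeriv (isOpen_actionBox n ρ) hfm hmem fun _ => Sum.inr j]
    exact norm_partialDeriv_le hf.2 (by rwa [sum_count_ofFn]) hmem
  · rw [angleSlice_eq_zero ha]
    have : (fun t : ℝ => (0 : (Fin n → ℝ) → ℂ) (θ + t • Pi.single j 1)) = fun _ => (0 : ℂ) := rfl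
    rw [this, iteratedDeriv_const]
    simp [ENNReal.toReal_nonneg]

/-- The `k`-th angular Fourier coefficient of the extension by zero. -/
def sliceCoeff (ρ : ℝ) (f : Phase ℝ n → ℝ) (k : Fin n → ℤ) (a : Fin n → ℝ) : ℂ :=
  angleCoeff (angleSlice ρ f a) k

theorem norm_sliceCoeff_le (hℓ : n + 1 ≤ ⌊ℓ⌋₊) (hp : AnglePeriodicOn f (actionBox n ρ))
    (hf : IsHolder ℓ (actionBox n ρ) f) (k : Fin n → ℤ) (a : Fin n → ℝ) :
    ‖sliceCoeff ρ f k a‖ ≤ decayWeight k * (holderNorm ℓ (actionBox n ρ) f).toReal :=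
  (twoPiPeriodic_angleSlice hp a).norm_angleCoeff_le_decayWeight
    (continuous_angleSlice hf.1.continuousOn a)
    (fun θ => by
      rw [angleSlice, Complex.norm_real]
      exact abs_boxExtend_le hf _)
    (fun j θ => contDiff_angleSlice_line (hf.1.of_le (by exact_mod_cast hℓ)) a j θ)
    (fun j θ t => norm_iteratedDeriv_angleSlice_line_le hf hℓ a j θ t) k

theorem summable_sliceCoeff (hℓ : n + 1 ≤ ⌊ℓ⌋₊) (hp : AnglePeriodicOn f (actionBox n ρ))
    (hf : IsHolder ℓ (actionBox n ρ) f) (a : Fin n → ℝ) :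
    Summable (angleCoeff (angleSlice ρ f a)) :=
  Summable.of_norm_bounded (summable_decayWeight.mul_right _)
    fun k => norm_sliceCoeff_le hℓ hp hf k a

theorem abs_le_of_sliceCoeff_ne_zero {k : Fin n → ℤ} {a : Fin n → ℝ}
    (h : sliceCoeff ρ f k a ≠ 0) (j : Fin n) : |a j| ≤ ρ := by
  by_contra hlt
  refine h ?_
  rw [sliceCoeff, angleSlice_eq_zero fun hall => hlt (hall j).le, angleCoeff_eq]
  simp

theorem measurable_sliceCoeff (hf : ContinuousOn f (actionBox n ρ)) (k : Fin n → ℤ) :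
    Measurable (sliceCoeff ρ f k) := by
  have hm : Measurable fun p : (Fin n → ℝ) × UnitAddTorus (Fin n) =>
      UnitAddTorus.mFourier (-k) p.2 * (boxExtend ρ f (realPhase p.1 (torusRep p.2)) : ℂ) := by
    refine ((UnitAddTorus.mFourier (-k)).continuous.measurable.comp measurable_snd).mul
      (Complex.measurable_ofReal.comp ((measurable_boxExtend hf).comp ?_))
    exact continuous_realPhase.measurable.comp
      (measurable_fst.prodMk (measurable_torusRep.comp measurable_snd))
  exact (hm.stronglyMeasurable.integral_prod_right' (ν := torusMeasure (Fin n))).measurable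

end Extension

/-! ### The smoothed function as a mollification -/

section Mollify

variable {n : ℕ} {ρ ℓ : ℝ} {f : Phase ℝ n → ℝ}

/-- The coefficients of the smoothed function. -/
def smoothCoeff (ρ s : ℝ) (f : Phase ℝ n → ℝ) (k : Fin n → ℤ) (I : EuclideanSpace ℂ (Fin n)) :
    ℂ :=
  freqCutoff s k * actionMollify s (sliceCoeff ρ f k) I

/-- The analytic smoothing of `f` at scale `s`. -/
def smooth (ρ s : ℝ) (f : Phase ℝ n → ℝ) (z : Phase ℂ n) : ℂ :=
  ∑ k ∈ freqBox n s, smoothCoeff ρ s f k (actions z) * character k (angles z)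

theorem integral_rescale (G : Phase ℝ n → ℝ) {s : ℝ} (hs : 0 < s) (x : Phase ℝ n) :
    ∫ u, G (s • u) • prodKern (Fin n ⊕ Fin n) (s⁻¹ • x - u)
      = ∫ u, G (x - s • u) • prodKern (Fin n ⊕ Fin n) u := by
  rw [← integral_sub_left_eq_self (fun u => G (x - s • u) • prodKern (Fin n ⊕ Fin n) u) volume
    (s⁻¹ • x)]
  refine integral_congr_ae (ae_of_all _ fun u => ?_)
  simp only
  rw [smul_sub, smul_inv_smul₀ hs.ne', sub_sub_cancel]

theorem polyGrowth_boxExtend (hf : IsHolder ℓ (actionBox n ρ) f) (s : ℝ) :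
    PolyGrowth volume fun u : Phase ℝ n => boxExtend ρ f (s • u) :=
  PolyGrowth.comp_smul (Q := 0) (measurable_boxExtend hf.1.continuousOn) ENNReal.toReal_nonneg
    (fun u => by simpa using abs_boxExtend_le hf u) s

theorem integrable_boxExtend_smul_prodKern (hf : IsHolder ℓ (actionBox n ρ) f) {s : ℝ}
    (x : Phase ℝ n) :
    Integrable fun u => boxExtend ρ f (x - s • u) • prodKern (Fin n ⊕ Fin n) u := by
  have hm : AEStronglyMeasurable (fun u => boxExtend ρ f (x - s • u))
      (volume : Measure (Phase ℝ n)) :=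
    ((measurable_boxExtend hf.1.continuousOn).comp (by fun_prop)).aestronglyMeasurable
  exact (prodKern (Fin n ⊕ Fin n)).integrable.bdd_smul _ hm
    (ae_of_all _ fun u => abs_boxExtend_le hf _)

/-- At real points the smoothed function is the mollification of the extension by zero. -/
theorem smooth_toComplex (hℓ : n + 1 ≤ ⌊ℓ⌋₊) (hp : AnglePeriodicOn f (actionBox n ρ))
    (hf : IsHolder ℓ (actionBox n ρ) f) {s : ℝ} (hs : 0 < s) (x : Phase ℝ n) :
    smooth ρ s f (toComplex x)
      = ∫ u, boxExtend ρ f (s • u) • prodKern (Fin n ⊕ Fin n) (s⁻¹ • x - u) := by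
  rw [integral_rescale _ hs, integral_phase (integrable_boxExtend_smul_prodKern hf x)]
  have hin : ∀ a : Fin n → ℝ, ∫ b : Fin n → ℝ, boxExtend ρ f (x - s • realPhase a b) •
      prodKern (Fin n ⊕ Fin n) (realPhase a b)
      = ∑ k ∈ freqBox n s, freqCutoff s k * character k (fun j => (x (Sum.inr j) : ℂ)) *
        (sliceCoeff ρ f k (fun j => x (Sum.inl j) - s * a j) * ∏ j, kern (a j)) := by
    intro a
    have h1 := (twoPiPeriodic_angleSlice hp
      fun j => x (Sum.inl j) - s * a j).integral_mul_prod_kern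
      (continuous_angleSlice hf.1.continuousOn _) (summable_sliceCoeff hℓ hp hf _) hs
      fun j => x (Sum.inr j)
    have h2 : ∀ b : Fin n → ℝ, boxExtend ρ f (x - s • realPhase a b) •
        prodKern (Fin n ⊕ Fin n) (realPhase a b) = (∏ j, kern (a j)) *
          (angleSlice ρ f (fun j => x (Sum.inl j) - s * a j)
            (fun j => x (Sum.inr j) - s * b j) * ∏ j, kern (b j)) := by
      intro b
      rw [realPhase_sub_smul, prodKern_realPhase, Complex.real_smul, angleSlice]
      ring
    simp only [h2]
    rw [integral_const_mul, h1, Finset.mul_sum]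
    refine Finset.sum_congr rfl fun k _ => ?_
    rw [sliceCoeff]
    ring
  simp only [hin]
  have hint : ∀ k, Integrable fun a : Fin n → ℝ =>
      sliceCoeff ρ f k (fun j => x (Sum.inl j) - s * a j) * ∏ j, kern (a j) := by
    intro k
    refine integrable_prod_kern.bdd_mul
      (c := decayWeight k * (holderNorm ℓ (actionBox n ρ) f).toReal) ?_
      (ae_of_all _ fun a => norm_sliceCoeff_le hℓ hp hf k _)
    exact ((measurable_sliceCoeff hf.1.continuousOn k).comp (by fun_prop)).aestronglyMeasurable
  rw [integral_finsetSum _ fun k _ => (hint k).const_mul _, smooth]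
  refine Finset.sum_congr rfl fun k _ => ?_
  rw [integral_const_mul, smoothCoeff, actionMollify]
  have hA : (fun j => (x (Sum.inl j) : ℂ)) = fun j => (actions (toComplex x)) j := rfl
  have hB : (fun j => (x (Sum.inr j) : ℂ)) = angles (toComplex x) := rfl
  -- Reflecting and translating `a` moves the real action from the merely measurable coefficient
  -- into the entire kernel, the form in which `actionMollify` admits complex actions.
  rw [← integral_sub_left_eq_self (fun a : Fin n → ℝ =>
    sliceCoeff ρ f k (fun j => x (Sum.inl j) - s * a j) * ∏ j, kern (a j)) volume
    (fun j => x (Sum.inl j) / s), hB]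
  have : ∀ u : Fin n → ℝ, sliceCoeff ρ f k (s • u) *
      ∏ j, kern (actions (toComplex x) j / s - u j)
      = sliceCoeff ρ f k (fun j => x (Sum.inl j) - s * ((fun j => x (Sum.inl j) / s) - u) j) *
        ∏ j, kern (((fun j => x (Sum.inl j) / s) - u) j : ℝ) := by
    intro u
    congr 1
    · congr 1
      ext j
      simp only [Pi.smul_apply, smul_eq_mul, Pi.sub_apply]
      field_simp
      ring
    · refine Finset.prod_congr rfl fun j _ => ?_
      congr 1
      simp only [Pi.sub_apply, Complex.ofReal_sub, Complex.ofReal_div]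
      rfl
  simp only [this]
  ring

theorem smooth_toComplex_im (hℓ : n + 1 ≤ ⌊ℓ⌋₊) (hp : AnglePeriodicOn f (actionBox n ρ))
    (hf : IsHolder ℓ (actionBox n ρ) f) {s : ℝ} (hs : 0 < s) (x : Phase ℝ n) :
    (smooth ρ s f (toComplex x)).im = 0 := by
  rw [← Complex.conj_eq_iff_im, smooth_toComplex hℓ hp hf hs, ← integral_conj]
  refine integral_congr_ae (ae_of_all _ fun u => ?_)
  simp only [Complex.real_smul, map_mul, Complex.conj_ofReal, prodKern_apply, map_prod,
    conj_kern_ofReal]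

/-- Mollification fixes the Taylor polynomial at `x`, so only the remainder is smoothed. The
identity holds for every `y` with `x` fixed, and can therefore be differentiated in `y` at `x`. -/
theorem smooth_sub_taylorPoly (hℓ : n + 1 ≤ ⌊ℓ⌋₊) (hp : AnglePeriodicOn f (actionBox n ρ))
    (hf : IsHolder ℓ (actionBox n ρ) f) {s : ℝ} (hs : 0 < s) {q : ℕ} {x : Phase ℝ n} {A : ℝ}
    (hℓ0 : 0 ≤ ℓ) (hA : 0 ≤ A)
    (hG : ∀ y, |boxExtend ρ f y - taylorPoly q f x y| ≤ A * ‖y - x‖ ^ ℓ) (y : Phase ℝ n) :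
    smooth ρ s f (toComplex y) = taylorPoly q f x y +
      ∫ u, (boxExtend ρ f (s • u) - taylorPoly q f x (s • u)) •
        prodKern (Fin n ⊕ Fin n) (s⁻¹ • y - u) := by
  have hK : RapidDecay (prodKern (Fin n ⊕ Fin n)) := fun N => by
    obtain ⟨B, hB⟩ := rapidDecay_iteratedFDeriv (prodKern (Fin n ⊕ Fin n)) 0 N
    exact ⟨B, fun u => by simpa using hB u⟩
  have hKc := (prodKern (Fin n ⊕ Fin n)).continuous
  have hm : Measurable fun y => boxExtend ρ f y - taylorPoly q f x y :=
    (measurable_boxExtend hf.1.continuousOn).sub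
      (contDiff_taylorPoly (r := 0) q f x).continuous.measurable
  have h1 := (polyGrowth_boxExtend hf s).integrable_smul_shift hK hKc (s⁻¹ • y)
  have h2 := (PolyGrowth.comp_smul (μ := volume) hm (by positivity)
    (bound_one_add_of_rpow_bound hℓ0 hA hG) s).integrable_smul_shift hK hKc (s⁻¹ • y)
  have h3 := integral_taylorPoly_smul_prodKern q f x y s
  rw [← integral_rescale _ hs] at h3
  rw [smooth_toComplex hℓ hp hf hs, ← h3, ← sub_eq_iff_eq_add, ← integral_sub h1 h2]
  refine integral_congr_ae (ae_of_all _ fun u => ?_)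
  simp only
  rw [← sub_smul, sub_sub_cancel]

end Mollify
end Smoothing
end

open scoped ENNReal
noncomputable section
namespace Smoothing

open Filter Topology Set MeasureTheory

/-! ### Analyticity and the two estimates -/

variable {n : ℕ} {ℓ ρ : ℝ} {f : Phase ℝ n → ℝ}

/-- The projection to the actions as a continuous linear map. -/
def actionsCLM (n : ℕ) : Phase ℂ n →L[ℂ] EuclideanSpace ℂ (Fin n) :=
  ((EuclideanSpace.equiv (Fin n) ℂ).symm : (Fin n → ℂ) →L[ℂ] EuclideanSpace ℂ (Fin n)) ∘L
    ContinuousLinearMap.pi fun j => EuclideanSpace.proj (Sum.inl j)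

theorem analyticOnNhd_smooth (hℓ : n + 1 ≤ ⌊ℓ⌋₊) (hp : AnglePeriodicOn f (actionBox n ρ))
    (hf : IsHolder ℓ (actionBox n ρ) f) {s : ℝ} (hs : 0 < s) (D : Set (Phase ℂ n)) :
    AnalyticOnNhd ℂ (smooth ρ s f) D := by
  unfold smooth smoothCoeff
  refine Finset.analyticOnNhd_fun_sum _ fun k _ => ?_
  have h1 : AnalyticOnNhd ℂ (fun z : Phase ℂ n =>
      actionMollify s (sliceCoeff ρ f k) (actions z)) D :=
    (analyticOnNhd_actionMollify hs (measurable_sliceCoeff hf.1.continuousOn k)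
      (norm_sliceCoeff_le hℓ hp hf k) fun a h => abs_le_of_sliceCoeff_ne_zero h).comp
      (f := fun z : Phase ℂ n => actions z) ((actionsCLM n).analyticOnNhd D)
      fun _ _ => mem_univ _
  have h2 : AnalyticOnNhd ℂ (fun z : Phase ℂ n => character k (angles z)) D := by
    have : (fun z : Phase ℂ n => character k (angles z)) = fun z => Complex.exp
        ((Complex.I • ∑ j, (k j : ℂ) • EuclideanSpace.proj (𝕜 := ℂ) (Sum.inr j) :
          Phase ℂ n →L[ℂ] ℂ) z) := by
      funext z
      simp [character, angles]
    rw [this]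
    exact (ContinuousLinearMap.analyticOnNhd _ D).cexp
  exact (analyticOnNhd_const.mul h1).mul h2

theorem anglePeriodicOn_smooth (s : ℝ) (D : Set (Phase ℂ n)) :
    AnglePeriodicOn (smooth ρ s f) D := fun z _ m =>
  Finset.sum_congr rfl fun k _ =>
    congrArg (smoothCoeff ρ s f k (actions z) * ·) (character_ofReal_add_two_pi k m (angles z))

/-- The derivatives at `x` of the difference between `f` and its mollification are those of the
mollification of the Taylor remainder of `f` at `x`. -/
theorem norm_iteratedFDeriv_sub_smooth_le (hℓ : n + 1 ≤ ⌊ℓ⌋₊)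
    (hp : AnglePeriodicOn f (actionBox n ρ)) (hf : IsHolder ℓ (actionBox n ρ) f) {s : ℝ}
    (hs : 0 < s) {x : Phase ℝ n} (hx : x ∈ actionBox n ρ) {A : ℝ} (hℓ0 : 0 ≤ ℓ) (hA : 0 ≤ A)
    (hG : ∀ y, |boxExtend ρ f y - taylorPoly ⌊ℓ⌋₊ f x y| ≤ A * ‖y - x‖ ^ ℓ) {m : ℕ}
    (hm : m ≤ ⌊ℓ⌋₊) :
    ‖iteratedFDeriv ℝ m (fun y => (f y : ℂ) - smooth ρ s f (toComplex y)) x‖ ≤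
      A * s ^ (ℓ - m) * ∫ u : Phase ℝ n,
        ‖u‖ ^ ℓ * ‖iteratedFDeriv ℝ m (prodKern (Fin n ⊕ Fin n)) u‖ := by
  have hD := isOpen_actionBox n ρ
  have hfx : ContDiffAt ℝ m f x :=
    (hf.1.contDiffAt (hD.mem_nhds hx)).of_le (by exact_mod_cast hm)
  have hP : ContDiffAt ℝ m (taylorPoly ⌊ℓ⌋₊ f x) x := (contDiff_taylorPoly _ f x).contDiffAt
  have hfP : ContDiffAt ℝ m (f - taylorPoly ⌊ℓ⌋₊ f x) x := hfx.sub hP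
  -- At its centre the Taylor polynomial matches all derivatives of `f` up to order `⌊ℓ⌋₊`, leaving
  -- only the mollified remainder.
  have hzero : iteratedFDeriv ℝ m (f - taylorPoly ⌊ℓ⌋₊ f x) x = 0 := by
    rw [iteratedFDeriv_sub_apply hfx hP, sub_eq_zero]
    ext v
    exact (iteratedFDeriv_taylorPoly hD hf.1 hx hm v).symm
  have hmeas : Measurable fun y => boxExtend ρ f y - taylorPoly ⌊ℓ⌋₊ f x y :=
    (measurable_boxExtend hf.1.continuousOn).sub
      (contDiff_taylorPoly (r := 0) _ f x).continuous.measurable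
  set N : Phase ℝ n → ℂ := fun y =>
    ∫ u, (boxExtend ρ f (s • u) - taylorPoly ⌊ℓ⌋₊ f x (s • u)) •
      prodKern (Fin n ⊕ Fin n) (s⁻¹ • y - u) with hN
  have hNc : ContDiff ℝ m N :=
    ((PolyGrowth.comp_smul (μ := volume) hmeas (by positivity)
      (bound_one_add_of_rpow_bound hℓ0 hA hG) s).hasFTaylorSeriesUpTo
      (prodKern (Fin n ⊕ Fin n))).contDiff.of_le (by exact_mod_cast le_top)
      |>.comp (contDiff_const_smul s⁻¹)
  have heq : (fun y => (f y : ℂ) - smooth ρ s f (toComplex y))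
      = (Complex.ofRealCLM ∘ (f - taylorPoly ⌊ℓ⌋₊ f x)) - N := by
    funext y
    rw [smooth_sub_taylorPoly hℓ hp hf hs hℓ0 hA hG y]
    simp [hN, sub_sub]
  rw [heq, iteratedFDeriv_sub_apply (Complex.ofRealCLM.contDiff.contDiffAt.comp x hfP)
    hNc.contDiffAt, Complex.ofRealCLM.iteratedFDeriv_comp_left hfP le_rfl, hzero]
  have hcomp : Complex.ofRealCLM.compContinuousMultilinearMap
      (0 : ContinuousMultilinearMap ℝ (fun _ : Fin m => Phase ℝ n) ℝ) = 0 := by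
    ext v
    simp
  rw [hcomp, zero_sub, norm_neg]
  exact norm_iteratedFDeriv_mollify_le (prodKern (Fin n ⊕ Fin n)) hmeas hℓ0 hA hs hG m

theorem norm_partialDeriv_le_norm_iteratedFDeriv {ι E : Type} [Fintype ι] [DecidableEq ι]
    [NormedAddCommGroup E] [NormedSpace ℝ E] (α : ι → ℕ) (g : EuclideanSpace ℝ ι → E)
    (x : EuclideanSpace ℝ ι) :
    ‖partialDeriv α g x‖ ≤ ‖iteratedFDeriv ℝ (∑ i, α i) g x‖ := by
  rw [partialDeriv, ← length_multiIndexList]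
  refine (ContinuousMultilinearMap.le_opNorm _ _).trans (le_of_eq ?_)
  simp

theorem exists_cNorm_sub_smooth_le (n : ℕ) {R ℓ : ℝ} (hR : 0 < R) (hℓ : n + 1 ≤ ⌊ℓ⌋₊) :
    ∃ C : ℝ, 0 < C ∧ ∀ s : ℝ, 0 < s → s ≤ 1 → ∀ f : Phase ℝ n → ℝ,
      AnglePeriodicOn f (actionBox n (2 * R)) → IsHolder ℓ (actionBox n (2 * R)) f →
      ∀ p ≤ ⌊ℓ⌋₊, cNorm p (actionBox n R)
        (fun x => (f x : ℂ) - smooth (2 * R) s f (toComplex x)) ≤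
          ENNReal.ofReal (C * s ^ (ℓ - p)) * holderNorm ℓ (actionBox n (2 * R)) f := by
  have hℓ1 : 1 ≤ ℓ := by
    have : (1 : ℕ) ≤ ⌊ℓ⌋₊ := by omega
    exact_mod_cast (Nat.le_floor_iff' one_ne_zero).1 this
  -- `B` is the constant of the global Taylor bound with `δ = min 1 R`: a ball of this radius around
  -- a point of the small box stays in the large one. Summing the kernel integrals into `T` gives
  -- one constant for all orders, and the final `+ 1` only ensures positivity.
  set B : ℝ := 2 * (Fintype.card (Fin n ⊕ Fin n) : ℝ) ^ ⌊ℓ⌋₊ + (min 1 R) ^ (-ℓ) *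
    (1 + ∑ m ∈ Finset.range (⌊ℓ⌋₊ + 1), (Fintype.card (Fin n ⊕ Fin n) : ℝ) ^ m) with hB
  have hδ : 0 < min 1 R := lt_min one_pos hR
  have hB0 : 0 ≤ B := by positivity
  let J : ℕ → ℝ := fun m => ∫ u : Phase ℝ n,
    ‖u‖ ^ ℓ * ‖iteratedFDeriv ℝ m (prodKern (Fin n ⊕ Fin n)) u‖
  have hJ : ∀ m, 0 ≤ J m := fun m => integral_nonneg fun u => by positivity
  set T : ℝ := ∑ m ∈ Finset.range (⌊ℓ⌋₊ + 1), J m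
  have hT0 : 0 ≤ T := Finset.sum_nonneg fun m _ => hJ m
  refine ⟨B * T + 1, by positivity, fun s hs hs1 f hp hf p hpq => ?_⟩
  set M := (holderNorm ℓ (actionBox n (2 * R)) f).toReal
  have hM : 0 ≤ M := ENNReal.toReal_nonneg
  refine iSup_le fun α => iSup_le fun hα => iSup₂_le fun x hx => ?_
  have hball := ball_subset_actionBox (min_le_right 1 R) hx
  have hG := abs_sub_taylorPoly_le_of_bounded hℓ1 hδ (min_le_left _ _)
    (isOpen_actionBox n (2 * R)) hf (g := boxExtend (2 * R) f)
    (fun y hy => (Set.indicator_of_mem hy f).symm) (abs_boxExtend_le hf) hball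
  rw [← ENNReal.ofReal_toReal hf.2.ne, ← ENNReal.ofReal_mul (by positivity), ← ofReal_norm]
  refine ENNReal.ofReal_le_ofReal ((norm_partialDeriv_le_norm_iteratedFDeriv _ _ _).trans
    ((norm_iteratedFDeriv_sub_smooth_le hℓ hp hf hs (hball (Metric.mem_ball_self hδ))
      (zero_le_one.trans hℓ1) (mul_nonneg hB0 hM) hG (hα.trans hpq)).trans ?_))
  -- Derivatives of order below `p` satisfy a better bound; `s ≤ 1` weakens it to the exponent `ℓ -
  -- p`.
  have h1 : s ^ (ℓ - (∑ i, α i : ℕ)) ≤ s ^ (ℓ - p) :=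
    Real.rpow_le_rpow_of_exponent_ge hs hs1
      (sub_le_sub_left (by exact_mod_cast hα) _)
  have h2 : J (∑ i, α i) ≤ T := Finset.single_le_sum (f := J) (fun m _ => hJ m)
    (Finset.mem_range.2 (by omega))
  calc B * M * s ^ (ℓ - (∑ i, α i : ℕ)) * J (∑ i, α i)
      ≤ B * M * s ^ (ℓ - p) * T := by gcongr
    _ = B * T * s ^ (ℓ - p) * M := by ring
    _ ≤ (B * T + 1) * s ^ (ℓ - p) * M := by gcongr; linarith

theorem exists_weightedFourierNorm_smooth_le (n : ℕ) {ℓ : ℝ} (hℓ : n + 1 ≤ ⌊ℓ⌋₊) :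
    ∃ C : ℝ, 0 < C ∧ ∀ (s ρ : ℝ), 0 < s → ∀ f : Phase ℝ n → ℝ,
      AnglePeriodicOn f (actionBox n ρ) → IsHolder ℓ (actionBox n ρ) f →
      weightedFourierNorm Set.univ s s (smooth ρ s f) ≤
        ENNReal.ofReal C * holderNorm ℓ (actionBox n ρ) f := by
  obtain ⟨C, hC, hmol⟩ := exists_norm_actionMollify_le n
  have hS : 0 ≤ ∑' k : Fin n → ℤ, decayWeight k := tsum_nonneg decayWeight_nonneg
  set L : ℝ := Real.exp (2 * Real.pi * n)
  have hL : 0 < L := Real.exp_pos _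
  refine ⟨C * L * (∑' k : Fin n → ℤ, decayWeight k) + 1, by positivity,
    fun s ρ hs f hp hf => iSup₂_le fun I hI => ?_⟩
  set M := (holderNorm ℓ (actionBox n ρ) f).toReal
  have hM : 0 ≤ M := ENNReal.toReal_nonneg
  have hIm : ∀ j, |(I j).im| ≤ s := fun j => by
    obtain ⟨x, -, hx⟩ := hI
    have h1 : |(I j).im| = |((I - toComplex x) j).im| := by simp [toComplex]
    rw [h1]
    exact (Complex.abs_im_le_norm _).trans ((PiLp.norm_apply_le _ j).trans hx.le)
  have hterm : ∀ k : Fin n → ℤ, ‖angleFourierCoeff (smooth ρ s f) k I‖ₑ *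
      ENNReal.ofReal (Real.exp ((∑ j, |(k j : ℝ)|) * s)) ≤
      ENNReal.ofReal (C * L * M * decayWeight k) := by
    intro k
    rw [show angleFourierCoeff (smooth ρ s f) k I = _ from angleFourierCoeff_sum _ _ k I]
    split_ifs
    · rw [← ofReal_norm, ← ENNReal.ofReal_mul (norm_nonneg _)]
      refine ENNReal.ofReal_le_ofReal ?_
      rw [smoothCoeff, norm_mul, mul_right_comm]
      -- The multiplier absorbs the weight, the `L¹` bound of the kernel handles the complex
      -- actions, and `decayWeight` makes the sum over `k` converge.
      calc ‖freqCutoff s k‖ * Real.exp ((∑ j, |(k j : ℝ)|) * s) *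
            ‖actionMollify s (sliceCoeff ρ f k) I‖
          ≤ L * (C * (decayWeight k * M)) :=
            mul_le_mul (norm_freqCutoff_mul_exp_le hs k)
              (hmol s _ _ I hs (norm_sliceCoeff_le hℓ hp hf k) hIm) (norm_nonneg _) hL.le
        _ = C * L * M * decayWeight k := by ring
    · simp
  refine (ENNReal.tsum_le_tsum hterm).trans ?_
  rw [← ENNReal.ofReal_tsum_of_nonneg
    (fun k => mul_nonneg (by positivity) (decayWeight_nonneg k))
    (summable_decayWeight.mul_left _), tsum_mul_left, ← ENNReal.ofReal_toReal hf.2.ne,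
    ← ENNReal.ofReal_mul (by positivity)]
  refine ENNReal.ofReal_le_ofReal ?_
  change _ ≤ _ * M
  nlinarith

end Smoothing
end

theorem theorem4p2 (n : ℕ) (hn : 1 ≤ n) (R : ℝ) (hR : 0 < R) (ℓ : ℝ) (hℓ : (n : ℤ) + 1 ≤ ⌊ℓ⌋) :
    ∃ C_A C_B : ℝ, 0 < C_A ∧ 0 < C_B ∧
      ∀ s : ℝ, 0 < s → s ≤ 1 →
      ∀ f : Smoothing.Phase ℝ n → ℝ,
        Smoothing.AnglePeriodicOn f (Smoothing.actionBox n (2 * R)) →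
        Smoothing.IsHolder ℓ (Smoothing.actionBox n (2 * R)) f →
        ∃ f_s : Smoothing.Phase ℂ n → ℂ,
          AnalyticOnNhd ℂ f_s (Smoothing.annulusStrip n s) ∧
          Smoothing.AnglePeriodicOn f_s (Smoothing.annulusStrip n s) ∧
          (∀ x : Smoothing.Phase ℝ n, (f_s (Smoothing.toComplex x)).im = 0) ∧
          Smoothing.IsTrigPolynomialOn f_s (Smoothing.annulusStrip n s) ∧
          (∀ p : ℕ, (p : ℤ) ≤ ⌊ℓ⌋ →
            Smoothing.cNorm p (Smoothing.actionBox n R)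
                (fun x => (f x : ℂ) - f_s (Smoothing.toComplex x)) ≤
              ENNReal.ofReal (C_A * s ^ (ℓ - (p : ℝ))) *
                Smoothing.holderNorm ℓ (Smoothing.actionBox n (2 * R)) f) ∧
          Smoothing.weightedFourierNorm Set.univ s s f_s ≤
            ENNReal.ofReal C_B * Smoothing.holderNorm ℓ (Smoothing.actionBox n (2 * R)) f := by
  -- The statement uses the integer floor, the Hölder norm the natural one.
  have hfl : ∀ m : ℕ, (m : ℤ) ≤ ⌊ℓ⌋ → m ≤ ⌊ℓ⌋₊ := fun m hm => by
    rw [← Int.floor_toNat]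
    omega
  have hℓ' : n + 1 ≤ ⌊ℓ⌋₊ := hfl _ (by exact_mod_cast hℓ)
  obtain ⟨C_A, hA, hCA⟩ := Smoothing.exists_cNorm_sub_smooth_le n hR hℓ'
  obtain ⟨C_B, hB, hCB⟩ := Smoothing.exists_weightedFourierNorm_smooth_le n hℓ'
  exact ⟨C_A, C_B, hA, hB, fun s hs hs1 f hp hf => ⟨Smoothing.smooth (2 * R) s f,
    Smoothing.analyticOnNhd_smooth hℓ' hp hf hs _, Smoothing.anglePeriodicOn_smooth s _,
    Smoothing.smooth_toComplex_im hℓ' hp hf hs,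
    ⟨Smoothing.freqBox n s, Smoothing.smoothCoeff (2 * R) s f, fun _ _ => rfl⟩,
    fun p hpq => hCA s hs hs1 f hp hf p (hfl p hpq), hCB s (2 * R) hs f hp hf⟩⟩
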